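/- **Setting.** Let $d,N\ge 1$, $\mathcal I=\{1,\dots,N\}$, and for $i\in\mathcal I$ let $f_i(x)=\mathrm{diag}(\lambda_i^{(1)},\dots,\lambda_i^{(d)})\,x+t_i$ with $\lambda_i^{(n)}\in(0,1)$ and $f_i([0,1]^d)\subseteq[0,1]^d$. Assume that $f_i\ne f_j$ on $[0,1]^d$ for $i\neq j$, and that for all $m\ne n$ in $\{1,\dots,d\}$ there is $i$ with $\lambda_i^{(m)}\neq\lambda_i^{(n)}$. The attractor of $(f_i)$ is a diagonal self-affine sponge. For a probability vector $\mathbf p=(p(i))_{i\in\mathcal I}$ with strictly positive entries, the self-affine measure $\nu_{\mathbf p}$ is the unique Borel probability measure on $\mathbb R^d$ with $\nu_{\mathbf p}=\sum_{i}p(i)\,\nu_{\mathbf p}\circ f_i^{-1}$. **Dimensions.** For a compactly supported Borel probability measure $\nu$, $\dim_{\mathrm A}\nu$ is the infimum of the $s\ge 0$ for which there is $C>0$ with $\frac{\nu(B(x,R))}{\nu(B(x,r))}\le C(R/r)^s$ for all $x\in\mathrm{supp}\,\nu$ and $0<r<R<|\mathrm{supp}\,\nu|$ (where $|\cdot|$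 is the diameter). If $|\mathrm{supp}\,\nu|>0$, $\dim_{\mathrm L}\nu$ is the supremum of the $s\ge0$ for which there is $C>0$ with $\frac{\nu(B(x,R))}{\nu(B(x,r))}\ge C(R/r)^s$ for all such $x,r,R$; if $|\mathrm{supp}\,\nu|=0$, then $\dim_{\mathrm L}\nu=0$. **Orderings.** For $\mathbf i\in\mathcal I^{\mathbb N}$, $0<r<1$ and a coordinate $n$ let $L_{\mathbf i}(r,n)\geq 1$ be the unique integer with $\prod_{\ell\le L_{\mathbf i}(r,n)}\lambda_{i_\ell}^{(n)}\le r<\prod_{\ell\le L_{\mathbf i}(r,n)-1}\lambda_{i_\ell}^{(n)}$. Let $\mathcal S_d$ be the set of permutations $\sigma=(\sigma_1,\dots,\sigma_d)$ of $\{1,\dots,d\}$. * $\mathcal A$ is the set of $\sigma\in\mathcal S_d$ for which there are $\mathbf i\in\mathcal I^{\mathbb N}$ and $0<r<1$ with $L_{\mathbf i}(r,\sigma_d)\le\dots\le L_{\mathbf i}(r,\sigma_1)$ such that, whenever $k<m$ and $L:=L_{\mathbf i}(r,k)=L_{\mathbf i}(r,m)$, the coordinate $k$ precedes $m$ in $\sigma$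 if and only if $\prod_{\ell\le L}\lambda_{i_\ell}^{(k)}\ge\prod_{\ell\le L}\lambda_{i_\ell}^{(m)}$. * $\mathcal B$ is the set of $\sigma\in\mathcal S_d$ for which there are $\mathbf i\in\mathcal I^{\mathbb N}$ and $0<r<1$ such that, with $L=L_{\mathbf i}(r,\sigma_d)$, $\prod_{\ell\le L}\lambda_{i_\ell}^{(\sigma_d)}<\prod_{\ell\le L}\lambda_{i_\ell}^{(\sigma_{d-1})}<\dots<\prod_{\ell\le L}\lambda_{i_\ell}^{(\sigma_1)}$. **Separation.** Let $E_n^\sigma$ be the span of the coordinate axes $\sigma_1,\dots,\sigma_n$ and $\Pi_n^\sigma$ the orthogonal projection onto it. The maps $f_i,f_j$ overlap exactly on $E_n^\sigma$ if $\Pi_n^\sigma\circ f_i=\Pi_n^\sigma\circ f_j$ on $[0,1]^d$. The very strong SPPC holds if for all $\sigma\in\mathcal A$, $1\le n\le d$ and $i,j\in\mathcal I$, either $f_i$ and $f_j$ overlap exactly on $E_n^\sigma$ or $\Pi_n^\sigma(f_i([0,1]^d))\cap\Pi_n^\sigma(f_j([0,1]^d))=\emptyset$. **Conditional probabilities.**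 For $1\leq n\leq d$ let $\mathcal I_n^\sigma$ be the set of $j\in\mathcal I$ for which no $i<j$ is such that $f_i$ and $f_j$ overlap exactly on $E_n^\sigma$ (so $\mathcal I_d^\sigma=\mathcal I$), and for $j\in\mathcal I$ let $\Pi_n^\sigma j$ be the unique $i\in\mathcal I_n^\sigma$ such that $f_i$ and $f_j$ overlap exactly on $E_n^\sigma$. Put $\mathcal I_0^\sigma=\{\emptyset\}$ and $\Pi_0^\sigma j=\emptyset$. Let $p_n^\sigma(i)=\sum_{j:\,\Pi_n^\sigma j=i}p(j)$ (so $p_0^\sigma(\emptyset)=1$) and, for $1\le n\le d$ and $i\in\mathcal I_n^\sigma$, $P_{n-1}^\sigma(i)=p_n^\sigma(i)/p_{n-1}^\sigma(\Pi_{n-1}^\sigma i)$. Define $$\overline S(\mathbf p,\sigma)=\sum_{n=1}^d\max_{i\in\mathcal I_n^\sigma}\frac{\log P_{n-1}^\sigma(i)}{\log\lambda_i^{(\sigma_n)}},\qquad \underline S(\mathbf p,\sigma)=\sum_{n=1}^d\min_{i\in\mathcal I_n^\sigma}\frac{\log P_{n-1}^\sigma(i)}{\log\lambda_i^{(\sigma_n)}}.$$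 **Natural measures.** For $0\le n\le d-1$ and $i\in\mathcal I_n^\sigma$ let $s_n^\sigma(i)$ be the unique real number with $\sum_{j\in\mathcal I_{n+1}^\sigma,\ \Pi_n^\sigma j=i}\big(\lambda_j^{(\sigma_{n+1})}\big)^{s_n^\sigma(i)}=1$, and let $q^\sigma(i)=\prod_{n=1}^d\big(\lambda^{(\sigma_n)}_{\Pi_n^\sigma i}\big)^{s_{n-1}^\sigma(\Pi_{n-1}^\sigma i)}$ for $i\in\mathcal I$. **Theorem.** Assume the very strong SPPC. Then $\mathcal A$ and $\mathcal B$ are non-empty, and for every probability vector $\mathbf p$ with strictly positive entries $$\max_{\sigma\in\mathcal B}\overline S(\mathbf p,\sigma)\le\dim_{\mathrm A}\nu_{\mathbf p}\le\max_{\sigma\in\mathcal A}\overline S(\mathbf p,\sigma) \quad\text{and}\quad \min_{\sigma\in\mathcal A}\underline S(\mathbf p,\sigma)\le\dim_{\mathrm L}\nu_{\mathbf p}\le\min_{\sigma\in\mathcal B}\underline S(\mathbf p,\sigma).$$ In particular, for every $\sigma\in\mathcal A$, $\mathbf q^\sigma=(q^\sigma(i))_{i\in\mathcal I}$ is a probability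 vector with strictly positive entries and $$\overline S(\mathbf q^\sigma,\sigma)=s_0^\sigma(\emptyset)+\sum_{n=1}^{d-1}\max_{i\in\mathcal I_n^\sigma}s_n^\sigma(i),\qquad \underline S(\mathbf q^\sigma,\sigma)=s_0^\sigma(\emptyset)+\sum_{n=1}^{d-1}\min_{i\in\mathcal I_n^\sigma}s_n^\sigma(i).$$ -/

import Mathlib

open MeasureTheory

/-- The unit cube `[0,1]^d` in Euclidean space. -/
def unitCube (d : ℕ) : Set (EuclideanSpace ℝ (Fin d)) :=
  {x | ∀ k, 0 ≤ x k ∧ x k ≤ 1}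

/-- The orthogonal projection of `ℝ^d` onto the span `E_n^σ` of the coordinate axes indexed by the
first `n` entries `σ 0, …, σ (n-1)` of `σ` (all coordinates are numbered from `0`). -/
noncomputable def coordProj {d : ℕ} (σ : Equiv.Perm (Fin d)) (n : ℕ)
    (x : EuclideanSpace ℝ (Fin d)) : EuclideanSpace ℝ (Fin d) :=
  WithLp.toLp 2 fun k => if (σ.symm k : ℕ) < n then x k else 0

/-- An iterated function system `f_i (x) = diag(λ_i^{(1)}, …, λ_i^{(d)}) x + t_i` of `N` diagonal
affine contractions of `[0,1]^d`, defining a self-affine sponge. The maps are pairwise different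
on the cube and all pairs of coordinates are distinguishable. -/
structure SpongeIFS (d N : ℕ) where
  /-- `scale i k` is the contraction ratio of `f_i` in the coordinate `k`. -/
  scale : Fin N → Fin d → ℝ
  /-- The translation vectors. -/
  trans : Fin N → EuclideanSpace ℝ (Fin d)
  scale_pos : ∀ i k, 0 < scale i k
  scale_lt_one : ∀ i k, scale i k < 1
  mapsTo_cube : ∀ i, ∀ x ∈ unitCube d,
    (WithLp.toLp 2 fun k => scale i k * x k + trans i k) ∈ unitCube d
  maps_ne : ∀ i j, i ≠ j → ∃ x ∈ unitCube d,
    (WithLp.toLp 2 fun k => scale i k * x k + trans i k : EuclideanSpace ℝ (Fin d)) ≠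
      WithLp.toLp 2 fun k => scale j k * x k + trans j k
  distinguishable : ∀ k m : Fin d, k ≠ m → ∃ i, scale i k ≠ scale i m

namespace SpongeIFS

variable {d N : ℕ} (S : SpongeIFS d N)

/-- The maps `f_i` of the system. -/
noncomputable def map (i : Fin N) (x : EuclideanSpace ℝ (Fin d)) : EuclideanSpace ℝ (Fin d) :=
  WithLp.toLp 2 fun k => S.scale i k * x k + S.trans i k

/-! ### Orderings of approximate cubes and of cylinders -/

/-- The length in coordinate `k` of the cylinder given by the first `L` letters of `w`. -/
noncomputable def side (w : ℕ → Fin N) (L : ℕ) (k : Fin d) : ℝ :=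
  ∏ l ∈ Finset.range L, S.scale (w l) k

/-- The `r`-stopping of `w` in coordinate `k`: the least `L` with `side w L k ≤ r`. For `0 < r < 1`
it is the unique `L ≥ 1` with `side w L k ≤ r < side w (L - 1) k`, see `stopping_spec`. -/
noncomputable def stopping (w : ℕ → Fin N) (r : ℝ) (k : Fin d) : ℕ :=
  sInf {L | S.side w L k ≤ r}

/-- The infinite word `w` determines a `σ`-ordered cube at scale `r`. -/
def IsOrderedCube (σ : Equiv.Perm (Fin d)) (w : ℕ → Fin N) (r : ℝ) : Prop :=
  (∀ m n : Fin d, m ≤ n → S.stopping w r (σ n) ≤ S.stopping w r (σ m)) ∧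
  ∀ k m : Fin d, k < m → S.stopping w r k = S.stopping w r m →
    (σ.symm k < σ.symm m ↔
      S.side w (S.stopping w r k) m ≤ S.side w (S.stopping w r k) k)

/-- The infinite word `w` determines a strictly `σ`-ordered cylinder at scale `r`: with `L` the
`r`-stopping of `w` in the last coordinate of `σ`, the sides of the level `L` cylinder satisfy
`side (σ (d-1)) < … < side (σ 0)`. -/
def IsStrictlyOrderedCylinder [NeZero d] (σ : Equiv.Perm (Fin d)) (w : ℕ → Fin N) (r : ℝ) : Prop :=
  StrictAnti fun n : Fin d =>
    S.side w (S.stopping w r (σ ⟨d - 1, Nat.sub_one_lt (NeZero.ne d)⟩)) (σ n)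

/-- The set `𝓐` of orderings witnessed by approximate cubes. Stopping times are defined for
scales `0 < r < 1` only. -/
def cubeOrders : Set (Equiv.Perm (Fin d)) :=
  {σ | ∃ w : ℕ → Fin N, ∃ r : ℝ, 0 < r ∧ r < 1 ∧ S.IsOrderedCube σ w r}

/-- The set `𝓑` of orderings witnessed by strictly ordered cylinders. -/
def cylinderOrders [NeZero d] : Set (Equiv.Perm (Fin d)) :=
  {σ | ∃ w : ℕ → Fin N, ∃ r : ℝ, 0 < r ∧ r < 1 ∧ S.IsStrictlyOrderedCylinder σ w r}

/-! ### Exact overlaps and the separation condition -/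

/-- `f_i` and `f_j` overlap exactly on `E_n^σ`. -/
def Overlap (σ : Equiv.Perm (Fin d)) (n : ℕ) (i j : Fin N) : Prop :=
  ∀ x ∈ unitCube d, coordProj σ n (S.map i x) = coordProj σ n (S.map j x)

/-- The very strong separation of principal projections condition. -/
def VeryStrongSPPC : Prop :=
  ∀ σ ∈ S.cubeOrders, ∀ n : ℕ, 1 ≤ n → n ≤ d → ∀ i j : Fin N,
    S.Overlap σ n i j ∨
      Disjoint (coordProj σ n '' (S.map i '' unitCube d)) (coordProj σ n '' (S.map j '' unitCube d))

open Classical in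
/-- The index set `𝓘_n^σ`: the index `j` is removed as soon as some `f_i` with `i < j` overlaps
exactly with `f_j` on `E_n^σ`. For `n = d` nothing is removed, and for `n = 0` only the index `0`
remains, which plays the role of the empty symbol. -/
noncomputable def index (σ : Equiv.Perm (Fin d)) (n : ℕ) : Finset (Fin N) :=
  Finset.univ.filter fun j => ∀ i, i < j → ¬ S.Overlap σ n i j

open Classical in
/-- The projection `Π_n^σ : 𝓘 → 𝓘_n^σ`: the (unique) index in `𝓘_n^σ` whose map overlaps exactly
with `f_j` on `E_n^σ`, that is, the least index with this property; see `proj_mem_index` and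
`eq_proj_iff`. -/
noncomputable def proj (σ : Equiv.Perm (Fin d)) (n : ℕ) (j : Fin N) : Fin N :=
  (Finset.univ.filter fun i => S.Overlap σ n i j).min'
    ⟨j, Finset.mem_filter.mpr ⟨Finset.mem_univ j, fun _ _ => rfl⟩⟩

variable {S}

theorem Overlap.symm {σ : Equiv.Perm (Fin d)} {n : ℕ} {i j : Fin N} (h : S.Overlap σ n i j) :
    S.Overlap σ n j i := fun x hx => (h x hx).symm

theorem Overlap.trans {σ : Equiv.Perm (Fin d)} {n : ℕ} {i j k : Fin N} (h : S.Overlap σ n i j)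
    (h' : S.Overlap σ n j k) : S.Overlap σ n i k := fun x hx => (h x hx).trans (h' x hx)

theorem Overlap.mono {σ : Equiv.Perm (Fin d)} {m n : ℕ} (hmn : m ≤ n) {i j : Fin N}
    (h : S.Overlap σ n i j) : S.Overlap σ m i j := by
  intro x hx
  ext k
  have := congrArg (fun y : EuclideanSpace ℝ (Fin d) => y k) (h x hx)
  simp only [coordProj] at this ⊢
  by_cases hk : (σ.symm k : ℕ) < m
  · simpa [hk, hk.trans_le hmn] using this
  · simp [hk]

variable (S)

theorem stopping_spec (w : ℕ → Fin N) {r : ℝ} (h0 : 0 < r) (h1 : r < 1) (k : Fin d) :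
    1 ≤ S.stopping w r k ∧ S.side w (S.stopping w r k) k ≤ r ∧
      r < S.side w (S.stopping w r k - 1) k := by
  classical
  have hne : {L | S.side w L k ≤ r}.Nonempty := by
    have hN : Nonempty (Fin N) := ⟨w 0⟩
    obtain ⟨i, hi⟩ := Finite.exists_max fun i => S.scale i k
    obtain ⟨L, hL⟩ := exists_pow_lt_of_lt_one h0 (S.scale_lt_one i k)
    refine ⟨L, le_trans ?_ hL.le⟩
    exact le_trans (Finset.prod_le_prod (fun l _ => (S.scale_pos _ _).le) fun l _ => hi (w l))
      (by simp)
  have hmem : S.side w (S.stopping w r k) k ≤ r := Nat.sInf_mem hne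
  have hpos : 1 ≤ S.stopping w r k := by
    rw [Nat.one_le_iff_ne_zero]
    intro h
    rw [h] at hmem
    simp only [side, Finset.range_zero, Finset.prod_empty] at hmem
    linarith
  refine ⟨hpos, hmem, ?_⟩
  by_contra hcon
  have h2 : S.stopping w r k ≤ S.stopping w r k - 1 := Nat.sInf_le (not_lt.mp hcon)
  omega

theorem mem_index {σ : Equiv.Perm (Fin d)} {n : ℕ} {j : Fin N} :
    j ∈ S.index σ n ↔ ∀ i, i < j → ¬ S.Overlap σ n i j := by
  simp [index]

theorem overlap_proj (σ : Equiv.Perm (Fin d)) (n : ℕ) (j : Fin N) :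
    S.Overlap σ n (S.proj σ n j) j := by
  unfold proj
  generalize_proofs h
  have := Finset.min'_mem _ h
  simpa only [Finset.mem_filter, Finset.mem_univ, true_and] using this

theorem proj_le {σ : Equiv.Perm (Fin d)} {n : ℕ} {i j : Fin N} (h : S.Overlap σ n i j) :
    S.proj σ n j ≤ i := by
  unfold proj
  apply Finset.min'_le
  simpa only [Finset.mem_filter, Finset.mem_univ, true_and] using h

theorem proj_mem_index (σ : Equiv.Perm (Fin d)) (n : ℕ) (j : Fin N) :
    S.proj σ n j ∈ S.index σ n :=
  (S.mem_index).mpr fun _ hi hov =>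
    absurd hi (not_lt.mpr (S.proj_le (hov.trans (S.overlap_proj σ n j))))

theorem eq_proj_iff (σ : Equiv.Perm (Fin d)) (n : ℕ) (i j : Fin N) :
    i = S.proj σ n j ↔ i ∈ S.index σ n ∧ S.Overlap σ n i j := by
  constructor
  · rintro rfl
    exact ⟨S.proj_mem_index σ n j, S.overlap_proj σ n j⟩
  · rintro ⟨hi, hov⟩
    have h1 := S.mem_index.mp hi
    have h2 := S.mem_index.mp (S.proj_mem_index σ n j)
    have h3 := hov.trans (S.overlap_proj σ n j).symm
    rcases lt_trichotomy i (S.proj σ n j) with h | h | h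
    · exact absurd h3 (h2 i h)
    · exact h
    · exact absurd h3.symm (h1 _ h)

theorem index_nonempty [NeZero N] (σ : Equiv.Perm (Fin d)) (n : ℕ) : (S.index σ n).Nonempty :=
  ⟨_, S.proj_mem_index σ n 0⟩

theorem index_zero [NeZero N] (σ : Equiv.Perm (Fin d)) : S.index σ 0 = {0} := by
  ext j
  simp only [mem_index, Overlap, coordProj, Finset.mem_singleton]
  constructor
  · intro h
    by_contra hj
    exact h 0 (Fin.pos_iff_ne_zero.mpr hj) (fun x _ => by simp)
  · rintro rfl i hi
    exact absurd hi (Fin.not_lt_zero i)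

/-! ### Projected and conditional probabilities, and the quantities in the dimension bounds -/

/-- The projected probabilities `p_n^σ(i)`. -/
noncomputable def projProb (p : Fin N → ℝ) (σ : Equiv.Perm (Fin d)) (n : ℕ) (i : Fin N) : ℝ :=
  ∑ j with S.proj σ n j = i, p j

/-- The conditional probability `p_{n+1}^σ(i) / p_n^σ(Π_n^σ i)`. -/
noncomputable def condProb (p : Fin N → ℝ) (σ : Equiv.Perm (Fin d)) (n : ℕ) (i : Fin N) : ℝ :=
  S.projProb p σ (n + 1) i / S.projProb p σ n (S.proj σ n i)

/-- The sum over the coordinates of the maxima of `log P / log λ`. -/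
noncomputable def upperSum [NeZero N] (p : Fin N → ℝ) (σ : Equiv.Perm (Fin d)) : ℝ :=
  ∑ n : Fin d, (S.index σ (n + 1)).sup' (S.index_nonempty σ (n + 1)) fun i =>
    Real.log (S.condProb p σ n i) / Real.log (S.scale i (σ n))

/-- The sum over the coordinates of the minima of `log P / log λ`. -/
noncomputable def lowerSum [NeZero N] (p : Fin N → ℝ) (σ : Equiv.Perm (Fin d)) : ℝ :=
  ∑ n : Fin d, (S.index σ (n + 1)).inf' (S.index_nonempty σ (n + 1)) fun i =>
    Real.log (S.condProb p σ n i) / Real.log (S.scale i (σ n))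

/-! ### Fibre similarity dimensions and coordinate-wise natural measures -/

/-- The fibre `𝓘_{n+1}^{σ,i}` above `i ∈ 𝓘_n^σ`. -/
noncomputable def fibre (σ : Equiv.Perm (Fin d)) (n : ℕ) (i : Fin N) : Finset (Fin N) :=
  {j ∈ S.index σ (n + 1) | S.proj σ n j = i}

theorem fibre_nonempty (σ : Equiv.Perm (Fin d)) (n : ℕ) {i : Fin N} (hi : i ∈ S.index σ n) :
    (S.fibre σ n i).Nonempty := by
  refine ⟨S.proj σ (n + 1) i, Finset.mem_filter.mpr ⟨S.proj_mem_index σ _ i, ?_⟩⟩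
  exact ((S.eq_proj_iff σ n _ _).mpr
    ⟨hi, ((S.overlap_proj σ (n + 1) i).mono (Nat.le_succ n)).symm⟩).symm

/-- Existence and uniqueness of the similarity dimension of the fibre above `i ∈ 𝓘_n^σ`. -/
theorem existsUnique_fibreDim (σ : Equiv.Perm (Fin d)) (n : Fin d) {i : Fin N}
    (hi : i ∈ S.index σ n) : ∃! s : ℝ, ∑ j ∈ S.fibre σ n i, S.scale j (σ n) ^ s = 1 := by
  have hne := S.fibre_nonempty σ n hi
  have hanti : StrictAnti fun s : ℝ => ∑ j ∈ S.fibre σ n i, S.scale j (σ n) ^ s := fun s t hst =>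
    Finset.sum_lt_sum_of_nonempty hne fun j _ =>
      Real.rpow_lt_rpow_of_exponent_gt (S.scale_pos _ _) (S.scale_lt_one _ _) hst
  have hcont : Continuous fun s : ℝ => ∑ j ∈ S.fibre σ n i, S.scale j (σ n) ^ s :=
    continuous_finsetSum _ fun j _ => Real.continuous_const_rpow (S.scale_pos _ _).ne'
  have hlim : Filter.Tendsto (fun s : ℝ => ∑ j ∈ S.fibre σ n i, S.scale j (σ n) ^ s)
      Filter.atTop (nhds 0) := by
    have := tendsto_finsetSum (f := fun j (s : ℝ) => S.scale j (σ n) ^ s) (a := fun _ => 0)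
      (x := Filter.atTop) (S.fibre σ n i) fun j _ => tendsto_rpow_atTop_of_base_lt_one _
        (by linarith [S.scale_pos j (σ n)]) (S.scale_lt_one j (σ n))
    simpa using this
  obtain ⟨t, ht1, ht0⟩ := ((hlim.eventually_lt_const one_pos).and
    (Filter.eventually_ge_atTop (0 : ℝ))).exists
  have h0 : (1 : ℝ) ≤ ∑ j ∈ S.fibre σ n i, S.scale j (σ n) ^ (0 : ℝ) := by
    simpa using Finset.card_pos.mpr hne
  obtain ⟨s, -, hs⟩ := intermediate_value_Icc' ht0 hcont.continuousOn ⟨ht1.le, h0⟩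
  exact ⟨s, hs, fun s' hs' => hanti.injective (hs'.trans hs.symm)⟩

open Classical in
/-- The similarity dimension `s_n^σ(i)` of the fibre above `i ∈ 𝓘_n^σ` (and `0` when
`i ∉ 𝓘_n^σ`, a value that is never used). -/
noncomputable def fibreDim (σ : Equiv.Perm (Fin d)) (n : Fin d) (i : Fin N) : ℝ :=
  if hi : i ∈ S.index σ n then (S.existsUnique_fibreDim σ n hi).choose else 0

/-- The probability vector `q^σ` of the `σ`-ordered coordinate-wise natural measure. -/
noncomputable def naturalProb (σ : Equiv.Perm (Fin d)) (i : Fin N) : ℝ :=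
  ∏ n : Fin d, S.scale (S.proj σ (n + 1) i) (σ n) ^ S.fibreDim σ n (S.proj σ n i)

/-! ### Self-affine measures -/

/-- `ν` is the self-affine measure with probabilities `p`: the Borel probability measure
satisfying `ν = ∑ p(i) ν ∘ f_i⁻¹`. -/
structure IsSelfAffineMeasure (p : Fin N → ℝ) (ν : Measure (EuclideanSpace ℝ (Fin d))) : Prop where
  isProbabilityMeasure : IsProbabilityMeasure ν
  eq_sum : ν = ∑ i, ENNReal.ofReal (p i) • ν.map (S.map i)

end SpongeIFS

/-! ### Assouad and lower dimension of a compactly supported measure -/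

/-- The Assouad dimension of a compactly supported Borel probability measure; it is `⊤` when no
exponent is admissible. -/
noncomputable def assouadDim {d : ℕ} (ν : Measure (EuclideanSpace ℝ (Fin d))) : EReal :=
  sInf {a | ∃ s : ℝ, a = s ∧ 0 ≤ s ∧ ∃ C : ℝ, 0 < C ∧ ∀ x ∈ ν.support, ∀ r R : ℝ,
    0 < r → r < R → R < Metric.diam ν.support →
      ν.real (Metric.closedBall x R) / ν.real (Metric.closedBall x r) ≤ C * (R / r) ^ s}

open Classical in
/-- The lower dimension of a compactly supported Borel probability measure. -/
noncomputable def lowerDim {d : ℕ} (ν : Measure (EuclideanSpace ℝ (Fin d))) : EReal :=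
  if Metric.diam ν.support = 0 then 0 else
  sSup {a | ∃ s : ℝ, a = s ∧ 0 ≤ s ∧ ∃ C : ℝ, 0 < C ∧ ∀ x ∈ ν.support, ∀ r R : ℝ,
    0 < r → r < R → R < Metric.diam ν.support →
      C * (R / r) ^ s ≤ ν.real (Metric.closedBall x R) / ν.real (Metric.closedBall x r)}

/-! Put `t = -log r`. At scale `r` a coordinate is active at level `l` if its stopping level exceeds
`l`. The symbolic cube around a word `w` consists of the words which, at each level, agree with `w`
in the active coordinates. Its mass is a product of values of `agreeProb`, and `energy` is minus the
logarithm of that product. A symbolic cube has diameter at most `d * exp (-t)`. Conversely, its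
active coordinates always form an initial segment of an ordering in `𝓐`, so the separation condition
keeps the words outside the cube at distance at least `δ * exp (-t)` from the point coded by `w`.
Hence masses of balls are, up to bounded changes of scale, exponentials of energies
(`exists_real_closedBall_le`, `le_real_closedBall`), and both dimensions are growth rates of the
energy in `t`.

Bounds over `𝓐`: if the cubes at two scales have the same ordering `σ`, the chain rule for
conditional probabilities splits the energy difference into one sum per coordinate. Each summand
lies between the minimal and the maximal ratio `log P / log λ` times `-log λ`, so the rate lies
between `lowerSum` and `upperSum`. The ordering may change along the way, but there are finitely
many orderings, and `le_add_mul_of_finite_coloring` jumps from the first to almost the last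
occurrence of each of them at bounded cost.

Bounds over `𝓑`: powers of a finite word that is strictly `σ`-ordered make the coordinates reach
log-size `τ` at levels that drift apart linearly in `τ`. For large `τ` there is room to insert,
where the coordinate `σ n` reaches `τ`, a block of the letter extremal for that coordinate. Between
the scales `τ` and `τ + T` every coordinate then sees, up to bounded error, only its extremal
letter, and the energy grows at exactly the extremal rate (`exists_word_with_zones`,
`exists_abs_energy_sub_le_of_mem_cylinderOrders`).

`𝓐` is nonempty by sorting stopping levels. `𝓑` is nonempty because distinguishable coordinates are
separated by letter frequencies avoiding finitely many polynomial roots. For the natural weights,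
summing over fibres telescopes, so the conditional probabilities are `λ ^ s` with `s` constant on
each fibre. -/

namespace SpongeIFS

variable {d N : ℕ} (S : SpongeIFS d N)

/-! ### Symbolic approximate cubes -/

/-- The maps `f_i` and `f_j` agree in the coordinates of `K`. -/
def AgreeOn (K : Finset (Fin d)) (i j : Fin N) : Prop :=
  ∀ k ∈ K, S.scale i k = S.scale j k ∧ S.trans i k = S.trans j k

/-- The first `n` coordinates in the ordering `σ`. -/
def initialCoords (σ : Equiv.Perm (Fin d)) (n : ℕ) : Finset (Fin d) :=
  Finset.univ.filter fun k => (σ.symm k : ℕ) < n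

theorem mem_initialCoords {σ : Equiv.Perm (Fin d)} {n : ℕ} {k : Fin d} :
    k ∈ initialCoords σ n ↔ (σ.symm k : ℕ) < n := by
  simp [initialCoords]

theorem exists_filter_eq_initialCoords {L : Fin d → ℕ} {σ : Equiv.Perm (Fin d)}
    (hL : Antitone fun n => L (σ n)) (l : ℕ) :
    ∃ m ≤ d, (Finset.univ.filter fun k => l < L k) = initialCoords σ m ∧
      ∀ n : Fin d, l < L (σ n) ↔ (n : ℕ) < m := by
  classical
  have hex : ∃ m : ℕ, ∀ n : Fin d, l < L (σ n) → (n : ℕ) < m := ⟨d, fun n _ => n.2⟩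
  -- The cut-off is the least strict bound for the active positions; a position below it has an
  -- active one at or after it, and monotonicity makes it active too.
  have hiff : ∀ n : Fin d, l < L (σ n) ↔ (n : ℕ) < Nat.find hex := by
    intro n
    refine ⟨Nat.find_spec hex n, fun hn => ?_⟩
    have := Nat.find_min hex hn
    push Not at this
    obtain ⟨n', hn', hle⟩ := this
    exact hn'.trans_le (hL (Fin.le_def.mpr hle))
  refine ⟨Nat.find hex, Nat.find_min' hex fun n _ => n.2, ?_, hiff⟩
  ext k
  rw [mem_initialCoords, ← hiff]
  simp

/-- Each coordinate of a map is affine in one variable, hence determined by its values at the two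
corners `0` and `1` of the cube. -/
theorem overlap_iff_agreeOn (σ : Equiv.Perm (Fin d)) (n : ℕ) (i j : Fin N) :
    S.Overlap σ n i j ↔ S.AgreeOn (initialCoords σ n) i j := by
  constructor
  · intro h k hk
    rw [mem_initialCoords] at hk
    have h0 := congrArg (fun y : EuclideanSpace ℝ (Fin d) => y k)
      (h (WithLp.toLp 2 fun _ => 0) (fun k => by simp))
    have h1 := congrArg (fun y : EuclideanSpace ℝ (Fin d) => y k)
      (h (WithLp.toLp 2 fun _ => 1) (fun k => by simp))
    simp only [coordProj, map, hk, if_true] at h0 h1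
    simp only [mul_zero, zero_add, mul_one] at h0 h1
    exact ⟨by linarith, h0⟩
  · intro h x _
    ext k
    simp only [coordProj, map]
    split_ifs with hk
    · obtain ⟨h1, h2⟩ := h k (mem_initialCoords.mpr hk)
      rw [h1, h2]
    · rfl

theorem proj_eq_proj_iff (σ : Equiv.Perm (Fin d)) (n : ℕ) (i j : Fin N) :
    S.proj σ n i = S.proj σ n j ↔ S.Overlap σ n i j := by
  rw [eq_proj_iff]
  constructor
  · rintro ⟨-, h⟩
    exact (S.overlap_proj σ n i).symm.trans h
  · intro h
    exact ⟨S.proj_mem_index σ n i, (S.overlap_proj σ n i).trans h⟩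

theorem proj_proj_of_le (σ : Equiv.Perm (Fin d)) {m n : ℕ} (hmn : m ≤ n) (i : Fin N) :
    S.proj σ m (S.proj σ n i) = S.proj σ m i :=
  (S.proj_eq_proj_iff σ m _ _).mpr ((S.overlap_proj σ n i).mono hmn)

theorem proj_eq_self {σ : Equiv.Perm (Fin d)} {n : ℕ} {i : Fin N} (hi : i ∈ S.index σ n) :
    S.proj σ n i = i :=
  ((S.eq_proj_iff σ n i i).mpr ⟨hi, fun _ _ => rfl⟩).symm

theorem scale_proj (σ : Equiv.Perm (Fin d)) (n : Fin d) (i : Fin N) :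
    S.scale (S.proj σ (n + 1) i) (σ n) = S.scale i (σ n) :=
  ((S.overlap_iff_agreeOn σ _ _ _).mp (S.overlap_proj σ (n + 1) i) (σ n)
    (by simp [mem_initialCoords])).1

open Classical in
/-- The total probability of the letters agreeing with `i` in the coordinates of `K`. -/
noncomputable def agreeProb (p : Fin N → ℝ) (K : Finset (Fin d)) (i : Fin N) : ℝ :=
  ∑ j with S.AgreeOn K i j, p j

/-- Passing to `agreeProb` removes the ordering: only the set of coordinates matters, so cubes with
different orderings can be compared. -/
theorem projProb_proj (p : Fin N → ℝ) (σ : Equiv.Perm (Fin d)) (n : ℕ) (i : Fin N) :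
    S.projProb p σ n (S.proj σ n i) = S.agreeProb p (initialCoords σ n) i := by
  unfold projProb agreeProb
  congr 1
  ext j
  simp only [Finset.mem_filter, Finset.mem_univ, true_and]
  rw [proj_eq_proj_iff, ← overlap_iff_agreeOn]
  exact ⟨Overlap.symm, Overlap.symm⟩

theorem agreeProb_empty (p : Fin N → ℝ) (i : Fin N) : S.agreeProb p ∅ i = ∑ j, p j := by
  simp [agreeProb, AgreeOn]

/-- The conditional probability of the letter `i` in the coordinate `σ n`. -/
noncomputable def letterProb (p : Fin N → ℝ) (σ : Equiv.Perm (Fin d)) (n : ℕ) (i : Fin N) : ℝ :=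
  S.condProb p σ n (S.proj σ (n + 1) i)

section Prob

variable {p : Fin N → ℝ} (hp : ∀ i, 0 < p i)
include hp

theorem le_agreeProb (K : Finset (Fin d)) (i : Fin N) : p i ≤ S.agreeProb p K i := by
  classical
  unfold agreeProb
  refine Finset.single_le_sum (f := p) (fun j _ => (hp j).le) ?_
  exact Finset.mem_filter.mpr ⟨Finset.mem_univ i, fun _ _ => ⟨rfl, rfl⟩⟩

theorem agreeProb_pos (K : Finset (Fin d)) (i : Fin N) : 0 < S.agreeProb p K i :=
  (hp i).trans_le (S.le_agreeProb hp K i)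

theorem agreeProb_anti {K K' : Finset (Fin d)} (h : K ⊆ K') (i : Fin N) :
    S.agreeProb p K' i ≤ S.agreeProb p K i := by
  classical
  unfold agreeProb
  refine Finset.sum_le_sum_of_subset_of_nonneg ?_ fun j _ _ => (hp j).le
  intro j
  simp only [Finset.mem_filter, Finset.mem_univ, true_and]
  exact fun hj k hk => hj k (h hk)

theorem agreeProb_succ (σ : Equiv.Perm (Fin d)) (n : ℕ) (i : Fin N) :
    S.agreeProb p (initialCoords σ (n + 1)) i =
      S.agreeProb p (initialCoords σ n) i * S.letterProb p σ n i := by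
  unfold letterProb condProb
  rw [projProb_proj, proj_proj_of_le _ _ (Nat.le_succ n), projProb_proj,
    mul_div_cancel₀ _ (S.agreeProb_pos hp _ i).ne']

theorem letterProb_eq (σ : Equiv.Perm (Fin d)) (n : ℕ) (i : Fin N) :
    S.letterProb p σ n i =
      S.agreeProb p (initialCoords σ (n + 1)) i / S.agreeProb p (initialCoords σ n) i := by
  rw [S.agreeProb_succ hp, mul_div_cancel_left₀ _ (S.agreeProb_pos hp _ i).ne']

theorem letterProb_pos (σ : Equiv.Perm (Fin d)) (n : ℕ) (i : Fin N) :
    0 < S.letterProb p σ n i := by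
  rw [S.letterProb_eq hp]
  exact div_pos (S.agreeProb_pos hp _ _) (S.agreeProb_pos hp _ _)

theorem letterProb_le_one (σ : Equiv.Perm (Fin d)) (n : ℕ) (i : Fin N) :
    S.letterProb p σ n i ≤ 1 := by
  rw [S.letterProb_eq hp, div_le_one (S.agreeProb_pos hp _ _)]
  refine S.agreeProb_anti hp (fun k hk => ?_) i
  rw [mem_initialCoords] at *
  omega

variable (hsum : ∑ i, p i = 1)
include hsum

theorem agreeProb_le_one (K : Finset (Fin d)) (i : Fin N) : S.agreeProb p K i ≤ 1 := by
  rw [← hsum, ← S.agreeProb_empty p i]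
  exact S.agreeProb_anti hp (Finset.empty_subset K) i

theorem neg_log_agreeProb_nonneg (K : Finset (Fin d)) (i : Fin N) :
    0 ≤ -Real.log (S.agreeProb p K i) :=
  neg_nonneg.mpr (Real.log_nonpos (S.agreeProb_pos hp K i).le (S.agreeProb_le_one hp hsum K i))

theorem neg_log_agreeProb_initialCoords (σ : Equiv.Perm (Fin d)) (n : ℕ) (i : Fin N) :
    -Real.log (S.agreeProb p (initialCoords σ n) i) =
      ∑ m ∈ Finset.range n, -Real.log (S.letterProb p σ m i) := by
  induction n with
  | zero =>
    have : initialCoords σ 0 = ∅ := by ext k; simp [mem_initialCoords]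
    rw [this, agreeProb_empty, hsum]
    simp
  | succ n ih =>
    rw [Finset.sum_range_succ, ← ih, S.agreeProb_succ hp,
      Real.log_mul (S.agreeProb_pos hp _ _).ne' (S.letterProb_pos hp _ _ _).ne']
    ring

end Prob

/-- Minus the logarithm of the mass of the symbolic cube around `w` that is determined by the
levels `L k` in the coordinates `k`. -/
noncomputable def energy (p : Fin N → ℝ) (w : ℕ → Fin N) (L : Fin d → ℕ) : ℝ :=
  ∑ l ∈ Finset.range (Finset.univ.sup L),
    -Real.log (S.agreeProb p (Finset.univ.filter fun k => l < L k) (w l))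

section Energy

variable {p : Fin N → ℝ} (hp : ∀ i, 0 < p i) (hsum : ∑ i, p i = 1)
include hp hsum

omit hp in
-- Levels at which no coordinate is active contribute `log 1 = 0`, so two energies can be summed
-- over a common range.
theorem energy_eq_sum_range (w : ℕ → Fin N) {L : Fin d → ℕ} {M : ℕ} (hM : ∀ k, L k ≤ M) :
    S.energy p w L = ∑ l ∈ Finset.range M,
      -Real.log (S.agreeProb p (Finset.univ.filter fun k => l < L k) (w l)) := by
  refine Finset.sum_subset ?_ ?_
  · exact Finset.range_mono (Finset.sup_le fun k _ => hM k)
  · intro l _ hl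
    have : (Finset.univ.filter fun k => l < L k) = ∅ := by
      ext k
      simp only [Finset.mem_filter, Finset.mem_univ, true_and, Finset.notMem_empty, iff_false,
        not_lt]
      rw [Finset.mem_range, not_lt] at hl
      exact (Finset.le_sup (f := L) (Finset.mem_univ k)).trans hl
    rw [this, agreeProb_empty, hsum]
    simp

/-- A level costs more for `L'` than for `L` only if some coordinate is active for `L'` and not for
`L`, and no level costs more than `P`. Each coordinate `k` accounts for at most `L' k - L k` such
levels. -/
theorem energy_le_add {P : ℝ} (hP : ∀ i, -Real.log (p i) ≤ P) (w : ℕ → Fin N)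
    (L L' : Fin d → ℕ) :
    S.energy p w L' ≤ S.energy p w L + P * ∑ k, |(L' k : ℝ) - L k| := by
  classical
  have hP0 : 0 ≤ P := by
    refine le_trans ?_ (hP (w 0))
    refine neg_nonneg.mpr (Real.log_nonpos (hp _).le ?_)
    rw [← hsum]
    exact Finset.single_le_sum (f := p) (fun j _ => (hp j).le) (Finset.mem_univ _)
  set M := Finset.univ.sup L ⊔ Finset.univ.sup L'
  have hM : ∀ k, L k ≤ M := fun k => le_sup_of_le_left (Finset.le_sup (Finset.mem_univ k))
  have hM' : ∀ k, L' k ≤ M := fun k => le_sup_of_le_right (Finset.le_sup (Finset.mem_univ k))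
  rw [S.energy_eq_sum_range hsum w hM, S.energy_eq_sum_range hsum w hM']
  have key : ∀ l, -Real.log (S.agreeProb p (Finset.univ.filter fun k => l < L' k) (w l)) ≤
      -Real.log (S.agreeProb p (Finset.univ.filter fun k => l < L k) (w l)) +
        ∑ k, if L k ≤ l ∧ l < L' k then P else 0 := by
    intro l
    have hnn : ∀ k ∈ Finset.univ, 0 ≤ (if L k ≤ l ∧ l < L' k then P else 0) := by
      intro k _
      split_ifs <;> simp [hP0]
    by_cases hk : ∃ k, L k ≤ l ∧ l < L' k
    · obtain ⟨k, hk⟩ := hk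
      have h1 : P ≤ ∑ k, if L k ≤ l ∧ l < L' k then P else 0 := by
        refine le_trans ?_ (Finset.single_le_sum hnn (Finset.mem_univ k))
        rw [if_pos hk]
      have h2 := S.neg_log_agreeProb_nonneg hp hsum (Finset.univ.filter fun k => l < L k) (w l)
      have h3 : -Real.log (S.agreeProb p (Finset.univ.filter fun k => l < L' k) (w l)) ≤ P :=
        (neg_le_neg (Real.log_le_log (hp _) (S.le_agreeProb hp _ _))).trans (hP (w l))
      linarith
    · push Not at hk
      have h1 := Finset.sum_nonneg hnn
      have h2 : -Real.log (S.agreeProb p (Finset.univ.filter fun k => l < L' k) (w l)) ≤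
          -Real.log (S.agreeProb p (Finset.univ.filter fun k => l < L k) (w l)) := by
        refine neg_le_neg (Real.log_le_log (S.agreeProb_pos hp _ _) (S.agreeProb_anti hp ?_ _))
        intro k
        simp only [Finset.mem_filter, Finset.mem_univ, true_and]
        intro h
        by_contra h'
        exact absurd h (not_lt.mpr (hk k (not_lt.mp h')))
      linarith
  refine (Finset.sum_le_sum fun l _ => key l).trans ?_
  rw [Finset.sum_add_distrib, Finset.sum_comm, Finset.mul_sum]
  gcongr with k _
  rw [← Finset.sum_filter, Finset.sum_const, nsmul_eq_mul, mul_comm]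
  refine mul_le_mul_of_nonneg_left ?_ hP0
  have h1 : (Finset.filter (fun l => L k ≤ l ∧ l < L' k) (Finset.range M)).card ≤ L' k - L k := by
    rw [← Nat.card_Ico]
    refine Finset.card_le_card fun l hl => ?_
    rw [Finset.mem_filter] at hl
    exact Finset.mem_Ico.mpr hl.2
  rcases le_total (L k) (L' k) with h | h
  · refine le_trans ?_ (le_abs_self _)
    rw [← Nat.cast_sub h]
    exact_mod_cast h1
  · rw [Nat.sub_eq_zero_of_le h] at h1
    rw [Nat.le_zero.mp h1]
    simp

/-- At each level the active set is an initial segment of `σ`, so the chain rule applies; exchanging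
the two sums groups the terms by coordinate. -/
theorem energy_of_antitone (w : ℕ → Fin N) {L : Fin d → ℕ} {σ : Equiv.Perm (Fin d)}
    (hL : Antitone fun n => L (σ n)) :
    S.energy p w L = ∑ n : Fin d, ∑ l ∈ Finset.range (L (σ n)),
      -Real.log (S.letterProb p σ n (w l)) := by
  classical
  set M := Finset.univ.sup L
  have hM : ∀ k, L k ≤ M := fun k => Finset.le_sup (Finset.mem_univ k)
  have h1 : ∀ n : Fin d, ∑ l ∈ Finset.range (L (σ n)), -Real.log (S.letterProb p σ n (w l)) =
      ∑ l ∈ Finset.range M, if l < L (σ n) then -Real.log (S.letterProb p σ n (w l)) else 0 := by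
    intro n
    rw [← Finset.sum_filter]
    congr 1
    ext l
    simp only [Finset.mem_range, Finset.mem_filter]
    exact ⟨fun h => ⟨h.trans_le (hM _), h⟩, fun h => h.2⟩
  rw [Finset.sum_congr rfl fun n _ => h1 n, Finset.sum_comm]
  refine Finset.sum_congr rfl fun l _ => ?_
  obtain ⟨m, hmd, hset, hiff⟩ := exists_filter_eq_initialCoords hL l
  have h2 : ∀ n : Fin d, (if l < L (σ n) then -Real.log (S.letterProb p σ n (w l)) else 0) =
      if (n : ℕ) < m then -Real.log (S.letterProb p σ n (w l)) else 0 := fun n =>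
    if_congr (hiff n) rfl rfl
  rw [hset, S.neg_log_agreeProb_initialCoords hp hsum, Finset.sum_congr rfl fun n _ => h2 n,
    Fin.sum_univ_eq_sum_range (fun n => if n < m then -Real.log (S.letterProb p σ n (w l)) else 0),
    ← Finset.sum_filter]
  congr 1
  ext n
  simp only [Finset.mem_range, Finset.mem_filter]
  omega

end Energy

/-! ### Logarithmic sides -/

/-- Minus the logarithm of `side w L k`. -/
noncomputable def logSide (w : ℕ → Fin N) (L : ℕ) (k : Fin d) : ℝ :=
  ∑ l ∈ Finset.range L, -Real.log (S.scale (w l) k)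

theorem neg_log_scale_pos (i : Fin N) (k : Fin d) : 0 < -Real.log (S.scale i k) :=
  neg_pos.mpr (Real.log_neg (S.scale_pos i k) (S.scale_lt_one i k))

theorem side_eq_exp (w : ℕ → Fin N) (L : ℕ) (k : Fin d) :
    S.side w L k = Real.exp (-S.logSide w L k) := by
  rw [side, logSide, ← Finset.sum_neg_distrib, Real.exp_sum]
  refine Finset.prod_congr rfl fun l _ => ?_
  rw [neg_neg, Real.exp_log (S.scale_pos _ _)]

theorem side_pos (w : ℕ → Fin N) (L : ℕ) (k : Fin d) : 0 < S.side w L k := by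
  rw [side_eq_exp]
  exact Real.exp_pos _

theorem logSide_succ (w : ℕ → Fin N) (L : ℕ) (k : Fin d) :
    S.logSide w (L + 1) k = S.logSide w L k + -Real.log (S.scale (w L) k) :=
  Finset.sum_range_succ _ _

theorem logSide_mono (w : ℕ → Fin N) (k : Fin d) : Monotone fun L => S.logSide w L k :=
  monotone_nat_of_le_succ fun L => by
    rw [logSide_succ]
    linarith [S.neg_log_scale_pos (w L) k]

theorem side_anti (w : ℕ → Fin N) (k : Fin d) : Antitone fun L => S.side w L k := by
  intro L L' h
  simp only [side_eq_exp]
  exact Real.exp_le_exp.mpr (neg_le_neg (S.logSide_mono w k h))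

/-- Bounds for the logarithms of the contraction ratios. -/
theorem exists_bounds_log_scale :
    ∃ a b : ℝ, 0 < a ∧ 0 < b ∧ ∀ i k, a ≤ -Real.log (S.scale i k) ∧ -Real.log (S.scale i k) ≤ b := by
  classical
  rcases isEmpty_or_nonempty (Fin N × Fin d) with h | h
  · exact ⟨1, 1, one_pos, one_pos, fun i k => (h.false (i, k)).elim⟩
  · obtain ⟨x, hx⟩ := Finite.exists_min fun x : Fin N × Fin d => -Real.log (S.scale x.1 x.2)
    obtain ⟨y, hy⟩ := Finite.exists_max fun x : Fin N × Fin d => -Real.log (S.scale x.1 x.2)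
    exact ⟨_, _, S.neg_log_scale_pos x.1 x.2, S.neg_log_scale_pos y.1 y.2,
      fun i k => ⟨hx (i, k), hy (i, k)⟩⟩

theorem mul_le_logSide_sub {a : ℝ} (ha : ∀ i k, a ≤ -Real.log (S.scale i k)) (w : ℕ → Fin N)
    (k : Fin d) {L L' : ℕ} (h : L ≤ L') :
    a * ((L' : ℝ) - L) ≤ S.logSide w L' k - S.logSide w L k := by
  induction L', h using Nat.le_induction with
  | base => simp
  | succ n hn ih =>
    rw [logSide_succ]
    push_cast
    linarith [ha (w n) k]

theorem abs_sub_le_of_logSide {a : ℝ} (ha0 : 0 < a) (ha : ∀ i k, a ≤ -Real.log (S.scale i k))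
    (w : ℕ → Fin N) (k : Fin d) (L L' : ℕ) :
    |(L' : ℝ) - L| ≤ |S.logSide w L' k - S.logSide w L k| / a := by
  rw [le_div_iff₀ ha0]
  rcases le_total L L' with h | h
  · have h1 := S.mul_le_logSide_sub ha w k h
    rw [abs_of_nonneg (by exact sub_nonneg.mpr (by exact_mod_cast h))]
    linarith [le_abs_self (S.logSide w L' k - S.logSide w L k)]
  · have h1 := S.mul_le_logSide_sub ha w k h
    rw [abs_of_nonpos (by exact sub_nonpos.mpr (by exact_mod_cast h))]
    linarith [neg_abs_le (S.logSide w L' k - S.logSide w L k)]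

/-- The stopping time at the scale `exp (-t)`. -/
noncomputable def stoppingExp (w : ℕ → Fin N) (t : ℝ) (k : Fin d) : ℕ :=
  S.stopping w (Real.exp (-t)) k

/-- Stopping overshoots `t` by at most the contribution of one letter. -/
theorem logSide_stoppingExp {b : ℝ} (hb : ∀ i k, -Real.log (S.scale i k) ≤ b) (w : ℕ → Fin N)
    {t : ℝ} (ht : 0 < t) (k : Fin d) :
    t ≤ S.logSide w (S.stoppingExp w t k) k ∧ S.logSide w (S.stoppingExp w t k) k ≤ t + b := by
  obtain ⟨h1, h2, h3⟩ := S.stopping_spec w (Real.exp_pos (-t))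
    (by simpa using ht) k
  rw [side_eq_exp, Real.exp_le_exp] at h2
  rw [side_eq_exp, Real.exp_lt_exp] at h3
  refine ⟨by unfold stoppingExp; linarith, ?_⟩
  have h4 : S.stoppingExp w t k = S.stoppingExp w t k - 1 + 1 := by
    unfold stoppingExp
    omega
  rw [h4, logSide_succ]
  unfold stoppingExp
  linarith [hb (w (S.stopping w (Real.exp (-t)) k - 1)) k]

theorem exists_isOrderedCube (w : ℕ → Fin N) (r : ℝ) :
    ∃ σ : Equiv.Perm (Fin d), S.IsOrderedCube σ w r := by
  classical
  -- Lexicographic key: larger stopping level first, then larger side. Sorting is stable, so equal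
  -- keys keep the order of their indices, as the convention for ties in `IsOrderedCube` demands.
  set f : Fin d → ℤ ×ₗ ℝ := fun k =>
    toLex (-(S.stopping w r k : ℤ), -S.side w (S.stopping w r k) k) with hf
  have hle : ∀ k m, f k ≤ f m → S.stopping w r m ≤ S.stopping w r k := by
    intro k m h
    rw [Prod.Lex.le_iff] at h
    simp only [hf, ofLex_toLex] at h
    rcases h with h | h
    · omega
    · omega
  obtain ⟨hmono, hst⟩ := Tuple.eq_sort_iff.mp (rfl : Tuple.sort f = Tuple.sort f)
  refine ⟨Tuple.sort f, fun m n hmn => hle _ _ (hmono hmn), fun k m hkm heq => ?_⟩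
  constructor
  · intro h
    have h1 := hmono h.le
    simp only [Function.comp, Equiv.apply_symm_apply] at h1
    rw [Prod.Lex.le_iff] at h1
    simp only [hf, ofLex_toLex, heq] at h1
    rcases h1 with h1 | h1
    · exact absurd h1 (lt_irrefl _)
    · rw [heq]
      linarith [h1.2]
  · intro h
    have h1 : f k ≤ f m := by
      rw [Prod.Lex.le_iff]
      simp only [hf, ofLex_toLex]
      rw [heq] at h ⊢
      exact Or.inr ⟨rfl, by linarith⟩
    by_contra hcon
    have hne : (Tuple.sort f).symm m ≠ (Tuple.sort f).symm k := fun h =>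
      hkm.ne' ((Tuple.sort f).symm.injective h)
    have hlt := lt_of_le_of_ne (not_lt.mp hcon) hne
    have h2 := hmono hlt.le
    simp only [Function.comp, Equiv.apply_symm_apply] at h2
    have h3 := hst _ _ hlt (by simpa using le_antisymm h2 h1)
    simp only [Equiv.apply_symm_apply] at h3
    exact absurd h3 (not_lt.mpr hkm.le)

theorem exists_cubeOrder (w : ℕ → Fin N) {t : ℝ} (ht : 0 < t) :
    ∃ σ ∈ S.cubeOrders, Antitone fun n => S.stoppingExp w t (σ n) := by
  obtain ⟨σ, hσ⟩ := S.exists_isOrderedCube w (Real.exp (-t))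
  exact ⟨σ, ⟨w, _, Real.exp_pos _, by simpa using ht, hσ⟩, fun m n h => hσ.1 m n h⟩

end SpongeIFS

namespace SpongeIFS

variable {d N : ℕ} (S : SpongeIFS d N)

/-! ### Cylinder maps -/

/-- The composition `f_{w 0} ∘ … ∘ f_{w (L-1)}`. -/
noncomputable def cyl (w : ℕ → Fin N) : ℕ → EuclideanSpace ℝ (Fin d) → EuclideanSpace ℝ (Fin d)
  | 0, x => x
  | L + 1, x => cyl w L (S.map (w L) x)

theorem cyl_succ (w : ℕ → Fin N) (L : ℕ) (x : EuclideanSpace ℝ (Fin d)) :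
    S.cyl w (L + 1) x = S.cyl w L (S.map (w L) x) := rfl

/-- `cyl` is defined by splitting off the innermost map, whereas the self-affinity of the measure
splits off the outermost one. -/
theorem cyl_succ' (w : ℕ → Fin N) (L : ℕ) (x : EuclideanSpace ℝ (Fin d)) :
    S.cyl w (L + 1) x = S.map (w 0) (S.cyl (fun l => w (l + 1)) L x) := by
  induction L generalizing x with
  | zero => rfl
  | succ L ih => rw [cyl_succ, ih, cyl_succ]

theorem map_apply (i : Fin N) (x : EuclideanSpace ℝ (Fin d)) (k : Fin d) :
    S.map i x k = S.scale i k * x k + S.trans i k := rfl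

theorem cyl_apply (w : ℕ → Fin N) (L : ℕ) (x : EuclideanSpace ℝ (Fin d)) (k : Fin d) :
    S.cyl w L x k = S.side w L k * x k + ∑ l ∈ Finset.range L, S.side w l k * S.trans (w l) k := by
  induction L generalizing x with
  | zero => simp [cyl, side]
  | succ L ih =>
    rw [cyl_succ, ih, map_apply, Finset.sum_range_succ, side, side, Finset.prod_range_succ]
    ring

theorem map_mem_unitCube (i : Fin N) {x : EuclideanSpace ℝ (Fin d)} (hx : x ∈ unitCube d) :
    S.map i x ∈ unitCube d := S.mapsTo_cube i x hx

theorem exists_cyl_eq {w : ℕ → Fin N} {l M : ℕ} (hl : l < M) {x : EuclideanSpace ℝ (Fin d)}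
    (hx : x ∈ unitCube d) : ∃ y ∈ unitCube d, S.cyl w M x = S.cyl w l (S.map (w l) y) := by
  induction M generalizing x with
  | zero => omega
  | succ M ih =>
    rcases Nat.lt_succ_iff_lt_or_eq.mp hl with h | rfl
    · rw [cyl_succ]
      exact ih h (S.map_mem_unitCube _ hx)
    · exact ⟨x, hx, rfl⟩

theorem trans_nonneg (i : Fin N) (k : Fin d) : 0 ≤ S.trans i k := by
  have := S.map_mem_unitCube i (x := WithLp.toLp 2 fun _ => 0) (fun k => by simp) k
  rw [map_apply] at this
  simpa using this.1

theorem scale_add_trans_le (i : Fin N) (k : Fin d) : S.scale i k + S.trans i k ≤ 1 := by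
  have := S.map_mem_unitCube i (x := WithLp.toLp 2 fun _ => 1) (fun k => by simp) k
  rw [map_apply] at this
  simpa using this.2

@[fun_prop]
theorem continuous_map (i : Fin N) : Continuous (S.map i) := by
  unfold map
  fun_prop

theorem continuous_cyl (w : ℕ → Fin N) (L : ℕ) : Continuous (S.cyl w L) := by
  induction L with
  | zero => exact continuous_id
  | succ L ih => exact ih.comp (S.continuous_map (w L))

theorem measurable_map (i : Fin N) : Measurable (S.map i) := (S.continuous_map i).measurable

end SpongeIFS

/-! ### Cubes and distances in Euclidean space -/

/-- The closed cube obtained by moving the faces of the unit cube outwards by `c`. -/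
def enlargedCube (d : ℕ) (c : ℝ) : Set (EuclideanSpace ℝ (Fin d)) :=
  {x | ∀ k, -c ≤ x k ∧ x k ≤ 1 + c}

theorem isClosed_enlargedCube (d : ℕ) (c : ℝ) : IsClosed (enlargedCube d c) := by
  simp only [enlargedCube, Set.ofPred_forall, Set.ofPred_and]
  exact isClosed_iInter fun k => (isClosed_le (by fun_prop) (by fun_prop)).inter
    (isClosed_le (by fun_prop) (by fun_prop))

theorem enlargedCube_zero (d : ℕ) : enlargedCube d 0 = unitCube d := by
  simp [enlargedCube, unitCube]

theorem enlargedCube_mono (d : ℕ) : Monotone (enlargedCube d) := by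
  intro c c' h x hx k
  have := hx k
  constructor <;> linarith

theorem dist_le_of_forall_abs_sub_le {d : ℕ} {x y : EuclideanSpace ℝ (Fin d)} {r : ℝ}
    (h : ∀ k, |x k - y k| ≤ r) : dist x y ≤ d * r := by
  rcases Nat.eq_zero_or_pos d with rfl | hd
  · rw [Subsingleton.elim x y]
    simp
  have hr : 0 ≤ r := (abs_nonneg _).trans (h ⟨0, hd⟩)
  rw [EuclideanSpace.dist_eq]
  refine Real.sqrt_le_iff.mpr ⟨by positivity, ?_⟩
  calc ∑ k, dist (x k) (y k) ^ 2 ≤ ∑ _k : Fin d, r ^ 2 := by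
        gcongr with k _
        rw [Real.dist_eq]
        exact h k
    _ = d * r ^ 2 := by simp
    _ ≤ (d * r) ^ 2 := by
        have : (1 : ℝ) ≤ d := by exact_mod_cast hd
        nlinarith [sq_nonneg r, mul_nonneg (sub_nonneg.mpr this) (by positivity : (0:ℝ) ≤ d * r ^ 2)]

theorem abs_sub_le_dist {d : ℕ} (x y : EuclideanSpace ℝ (Fin d)) (k : Fin d) :
    |x k - y k| ≤ dist x y := by
  rw [dist_eq_norm]
  exact (PiLp.norm_apply_le (x - y) k)

theorem isCompact_unitCube (d : ℕ) : IsCompact (unitCube d) := by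
  rw [← enlargedCube_zero]
  refine Metric.isCompact_of_isClosed_isBounded (isClosed_enlargedCube d 0) ?_
  rw [Metric.isBounded_iff]
  refine ⟨d * 1, fun x hx y hy => dist_le_of_forall_abs_sub_le fun k => abs_sub_le_iff.mpr ?_⟩
  have h1 := hx k
  have h2 := hy k
  constructor <;> linarith

namespace SpongeIFS

variable {d N : ℕ} {S : SpongeIFS d N}

/-! ### The support of a self-affine measure -/

namespace IsSelfAffineMeasure

variable {p : Fin N → ℝ} {ν : Measure (EuclideanSpace ℝ (Fin d))}
  (hν : S.IsSelfAffineMeasure p ν)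
include hν

theorem measure_eq {A : Set (EuclideanSpace ℝ (Fin d))} (hA : MeasurableSet A) :
    ν A = ∑ i, ENNReal.ofReal (p i) * ν (S.map i ⁻¹' A) := by
  conv_lhs => rw [hν.eq_sum]
  rw [Measure.finsetSum_apply]
  refine Finset.sum_congr rfl fun i _ => ?_
  rw [Measure.smul_apply, Measure.map_apply (S.measurable_map i) hA, smul_eq_mul]

variable (hp : ∀ i, 0 < p i)
include hp

theorem real_eq {A : Set (EuclideanSpace ℝ (Fin d))} (hA : MeasurableSet A) :
    ν.real A = ∑ i, p i * ν.real (S.map i ⁻¹' A) := by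
  have := hν.isProbabilityMeasure
  rw [measureReal_def, hν.measure_eq hA, ENNReal.toReal_sum fun i _ =>
    ENNReal.mul_ne_top ENNReal.ofReal_ne_top (measure_ne_top _ _)]
  refine Finset.sum_congr rfl fun i _ => ?_
  rw [ENNReal.toReal_mul, ENNReal.toReal_ofReal (hp i).le, measureReal_def]

variable (hsum : ∑ i, p i = 1)
include hsum

/-- Every `f_i` maps the `c`-enlarged cube into the `q * c`-enlarged one; average over `i`. -/
theorem real_enlargedCube_le {q : ℝ} (hq : ∀ i k, S.scale i k ≤ q) {c : ℝ} (hc : 0 ≤ c) :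
    ν.real (enlargedCube d c) ≤ ν.real (enlargedCube d (q * c)) := by
  have := hν.isProbabilityMeasure
  rw [hν.real_eq hp (isClosed_enlargedCube d (q * c)).measurableSet,
    ← one_mul (ν.real (enlargedCube d c)), ← hsum, Finset.sum_mul]
  gcongr with i _
  · exact (hp i).le
  · exact measure_ne_top _ _
  · intro x hx k
    have h1 := hx k
    have h2 := S.trans_nonneg i k
    have h3 := S.scale_add_trans_le i k
    have h4 := S.scale_pos i k
    have h5 := mul_le_mul_of_nonneg_right (hq i k) hc
    rw [map_apply]
    constructor
    · nlinarith [mul_le_mul_of_nonneg_left h1.1 h4.le]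
    · nlinarith [mul_le_mul_of_nonneg_left h1.2 h4.le]

/-- Compact support is derived from self-affinity. Iterating the contraction of enlarged cubes shows
that each of them has no more mass than the unit cube, and together they exhaust the space. -/
theorem real_unitCube : ν.real (unitCube d) = 1 := by
  have := hν.isProbabilityMeasure
  obtain ⟨a, b, ha, -, hab⟩ := S.exists_bounds_log_scale
  set q := Real.exp (-a) with hqdef
  have hq0 : 0 < q := Real.exp_pos _
  have hq1 : q < 1 := by rw [hqdef]; simpa using ha
  have hq : ∀ i k, S.scale i k ≤ q := fun i k => by
    rw [hqdef, ← Real.log_le_iff_le_exp (S.scale_pos i k)]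
    linarith [(hab i k).1]
  have hcont : ∀ c : ℝ, 0 ≤ c → ν.real (enlargedCube d c) ≤ ν.real (unitCube d) := by
    intro c hc
    have hstep : ∀ n : ℕ, ν.real (enlargedCube d c) ≤ ν.real (enlargedCube d (q ^ n * c)) := by
      intro n
      induction n with
      | zero => simp
      | succ n ih =>
        refine ih.trans ?_
        rw [pow_succ', mul_assoc]
        exact hν.real_enlargedCube_le hp hsum hq (by positivity)
    have hq' : Filter.Tendsto (fun n : ℕ => q ^ n * c) Filter.atTop (nhds 0) := by
      simpa using (tendsto_pow_atTop_nhds_zero_of_lt_one hq0.le hq1).mul_const c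
    have hInter : ⋂ n : ℕ, enlargedCube d (q ^ n * c) = unitCube d := by
      rw [← enlargedCube_zero]
      refine Set.Subset.antisymm ?_ (Set.subset_iInter fun n => enlargedCube_mono d (by positivity))
      intro x hx k
      rw [Set.mem_iInter] at hx
      exact ⟨le_of_tendsto hq'.neg (Filter.Eventually.of_forall fun n => (hx n k).1),
        ge_of_tendsto (hq'.const_add 1) (Filter.Eventually.of_forall fun n => (hx n k).2)⟩
    have htend := tendsto_measure_iInter_atTop (μ := ν)
      (s := fun n : ℕ => enlargedCube d (q ^ n * c))
      (fun n => (isClosed_enlargedCube d _).measurableSet.nullMeasurableSet)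
      (fun m n hmn => enlargedCube_mono d (mul_le_mul_of_nonneg_right
        (pow_le_pow_of_le_one hq0.le hq1.le hmn) hc)) ⟨0, measure_ne_top _ _⟩
    rw [hInter] at htend
    exact ge_of_tendsto ((ENNReal.tendsto_toReal (measure_ne_top _ _)).comp htend)
      (Filter.Eventually.of_forall hstep)
  have hUnion : ⋃ n : ℕ, enlargedCube d (n : ℝ) = Set.univ := by
    refine Set.eq_univ_of_forall fun x => ?_
    obtain ⟨n, hn⟩ := exists_nat_gt ‖x‖
    refine Set.mem_iUnion.mpr ⟨n, fun k => ?_⟩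
    have := abs_le.mp ((PiLp.norm_apply_le x k).trans hn.le)
    constructor <;> linarith [this.1, this.2]
  have htend := tendsto_measure_iUnion_atTop (μ := ν) (s := fun n : ℕ => enlargedCube d (n : ℝ))
    (fun m n hmn => enlargedCube_mono d (by exact_mod_cast hmn))
  rw [hUnion] at htend
  have h1 : ν.real Set.univ ≤ ν.real (unitCube d) :=
    le_of_tendsto ((ENNReal.tendsto_toReal (measure_ne_top _ _)).comp htend)
      (Filter.Eventually.of_forall fun n => hcont n (Nat.cast_nonneg n))
  exact le_antisymm measureReal_le_one (by simpa using h1)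

theorem support_subset_unitCube : ν.support ⊆ unitCube d := by
  have := hν.isProbabilityMeasure
  refine Measure.support_subset_of_isClosed (isCompact_unitCube d).isClosed ?_
  rw [mem_ae_iff, prob_compl_eq_zero_iff (isCompact_unitCube d).measurableSet]
  have := hν.real_unitCube hp hsum
  rwa [measureReal_def, ENNReal.toReal_eq_one_iff] at this

omit hν hp hsum in
theorem isClosed_support : IsClosed ν.support := Measure.isClosed_support

theorem isCompact_support : IsCompact ν.support :=
  (isCompact_unitCube d).of_isClosed_subset isClosed_support (hν.support_subset_unitCube hp hsum)

omit hsum in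
theorem map_mem_support (i : Fin N) {x : EuclideanSpace ℝ (Fin d)} (hx : x ∈ ν.support) :
    S.map i x ∈ ν.support := by
  rw [Measure.support_eq_forall_isOpen] at *
  intro u hu huo
  have h1 := hx (S.map i ⁻¹' u) hu (huo.preimage (S.continuous_map i))
  rw [hν.measure_eq huo.measurableSet]
  refine lt_of_lt_of_le ?_ (Finset.single_le_sum
    (f := fun i => ENNReal.ofReal (p i) * ν (S.map i ⁻¹' u)) (fun j _ => bot_le)
    (Finset.mem_univ i))
  exact ENNReal.mul_pos (ENNReal.ofReal_pos.mpr (hp i)).ne' h1.ne'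

/-- The union of the images of the compact support is closed and, by self-affinity, of full measure.
-/
theorem exists_map_eq {x : EuclideanSpace ℝ (Fin d)} (hx : x ∈ ν.support) :
    ∃ i, ∃ y ∈ ν.support, x = S.map i y := by
  have hcl : IsClosed (⋃ i, S.map i '' ν.support) :=
    isClosed_iUnion_of_finite fun i =>
      ((hν.isCompact_support hp hsum).image (S.continuous_map i)).isClosed
  have hsub : ν.support ⊆ ⋃ i, S.map i '' ν.support := by
    refine Measure.support_subset_of_isClosed hcl ?_
    rw [mem_ae_iff, hν.measure_eq hcl.measurableSet.compl]
    refine Finset.sum_eq_zero fun i _ => ?_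
    rw [measure_mono_null ?_ (Measure.measure_compl_support (μ := ν)), mul_zero]
    intro y hy hys
    exact hy (Set.mem_iUnion.mpr ⟨i, y, hys, rfl⟩)
  obtain ⟨i, y, hy, rfl⟩ := Set.mem_iUnion.mp (hsub hx)
  exact ⟨i, y, hy, rfl⟩

theorem exists_code {x : EuclideanSpace ℝ (Fin d)} (hx : x ∈ ν.support) :
    ∃ w : ℕ → Fin N, ∀ L, ∃ y ∈ ν.support, x = S.cyl w L y := by
  choose i y hy hxy using fun z : ν.support => hν.exists_map_eq hp hsum z.2
  let z : ℕ → ν.support := fun n => Nat.rec ⟨x, hx⟩ (fun _ z => ⟨y z, hy z⟩) n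
  refine ⟨fun l => i (z l), fun L => ⟨(z L).1, (z L).2, ?_⟩⟩
  induction L with
  | zero => rfl
  | succ L ih =>
    have hz : S.map (i (z L)) (z (L + 1)).1 = (z L).1 := (hxy (z L)).symm
    rw [cyl_succ, hz]
    exact ih

/-- The images of the support under the cylinder maps along `w` are nested nonempty compact sets,
hence have a common point. -/
theorem exists_coded (w : ℕ → Fin N) :
    ∃ x ∈ ν.support, ∀ L, ∃ y ∈ ν.support, x = S.cyl w L y := by
  have := hν.isProbabilityMeasure
  have hne : ν.support.Nonempty := Measure.nonempty_support (IsProbabilityMeasure.ne_zero ν)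
  have hc := hν.isCompact_support hp hsum
  obtain ⟨x, hx⟩ := IsCompact.nonempty_iInter_of_sequence_nonempty_isCompact_isClosed
    (fun L => S.cyl w L '' ν.support)
    (fun L => by
      rintro _ ⟨y, hy, rfl⟩
      exact ⟨_, hν.map_mem_support hp _ hy, rfl⟩)
    (fun L => hne.image _) (hc.image (S.continuous_cyl w 0))
    (fun L => (hc.image (S.continuous_cyl w L)).isClosed)
  rw [Set.mem_iInter] at hx
  have h : ∀ L, ∃ y ∈ ν.support, x = S.cyl w L y := fun L => by
    obtain ⟨y, hy, h⟩ := hx L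
    exact ⟨y, hy, h.symm⟩
  obtain ⟨y, hy, h0⟩ := h 0
  exact ⟨x, by rw [h0]; exact hy, h⟩

/-! ### The mass of symbolic cubes -/

/-- A set meeting only cylinders with letters in `J l` at the levels `l < L` has small mass. -/
theorem real_le_prod {A : Set (EuclideanSpace ℝ (Fin d))} (hA : MeasurableSet A) (L : ℕ)
    (J : ℕ → Finset (Fin N))
    (hJ : ∀ v : ℕ → Fin N, ∀ x ∈ ν.support, S.cyl v L x ∈ A → ∀ l < L, v l ∈ J l) :
    ν.real A ≤ ∏ l ∈ Finset.range L, ∑ i ∈ J l, p i := by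
  have := hν.isProbabilityMeasure
  induction L generalizing A J with
  | zero => simp
  | succ L ih =>
    rw [hν.real_eq hp hA, Finset.prod_range_succ', mul_comm, Finset.sum_mul]
    -- Letters outside `J 0` contribute nothing: a support point in such a preimage of `A`, with
    -- that letter prepended to its code, would violate `hJ` at level `0`.
    rw [← Finset.sum_subset (Finset.subset_univ (J 0))]
    · gcongr with i hi
      · exact (hp i).le
      · refine ih (S.measurable_map i hA) (fun l => J (l + 1)) fun v x hx hxA l hl => ?_
        have := hJ (fun n => Nat.casesOn n i v) x hx (by rw [cyl_succ']; exact hxA) (l + 1)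
          (by omega)
        exact this
    · intro i _ hi
      have : ν.real (S.map i ⁻¹' A) = 0 := by
        rw [measureReal_eq_zero_iff]
        refine measure_mono_null ?_ (Measure.measure_compl_support (μ := ν))
        intro y hy hys
        obtain ⟨v, hv⟩ := hν.exists_code hp hsum hys
        obtain ⟨x, hx, rfl⟩ := hv L
        exact hi (hJ (fun n => Nat.casesOn n i v) x hx (by rw [cyl_succ']; exact hy) 0
          (by omega))
      rw [this, mul_zero]

/-- A set containing all cylinders with letters in `J l` at the levels `l < L` has large mass. -/
theorem prod_le_real {A : Set (EuclideanSpace ℝ (Fin d))} (hA : MeasurableSet A) (L : ℕ)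
    (J : ℕ → Finset (Fin N))
    (hJ : ∀ v : ℕ → Fin N, (∀ l < L, v l ∈ J l) → ∀ x ∈ unitCube d, S.cyl v L x ∈ A) :
    ∏ l ∈ Finset.range L, ∑ i ∈ J l, p i ≤ ν.real A := by
  have := hν.isProbabilityMeasure
  induction L generalizing A J with
  | zero =>
    rw [Finset.range_zero, Finset.prod_empty, ← hν.real_unitCube hp hsum]
    refine measureReal_mono fun x hx => ?_
    obtain ⟨i⟩ : Nonempty (Fin N) := by
      by_contra h
      rw [not_nonempty_iff] at h
      simp at hsum
    exact hJ (fun _ => i) (fun l hl => absurd hl (Nat.not_lt_zero l)) x hx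
  | succ L ih =>
    rw [hν.real_eq hp hA, Finset.prod_range_succ', mul_comm, Finset.sum_mul]
    refine le_trans ?_ (Finset.sum_le_sum_of_subset_of_nonneg (Finset.subset_univ (J 0))
      fun i _ _ => mul_nonneg (hp i).le measureReal_nonneg)
    refine Finset.sum_le_sum fun i hi => mul_le_mul_of_nonneg_left ?_ (hp i).le
    refine ih (S.measurable_map i hA) (fun l => J (l + 1)) fun v hv x hx => ?_
    -- `Nat.casesOn n i v` is the word `v` with the letter `i` prepended.
    have := hJ (fun n => Nat.casesOn n i v) (fun l hl => by
      cases l with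
      | zero => exact hi
      | succ l => exact hv l (by omega)) x hx
    rw [cyl_succ'] at this
    exact this

end IsSelfAffineMeasure

end SpongeIFS

/-- A function on `(0, ∞)` growing at rate at most `h` between any two points of the same colour
grows at rate at most `h`, up to an additive constant, if there are finitely many colours. -/
theorem le_add_mul_of_finite_coloring {ι : Type*} [Fintype ι] (c : ℝ → ι) (G : ℝ → ℝ) {h C : ℝ}
    (hC : 0 ≤ C)
    (hcol : ∀ s t, 0 < s → s ≤ t → c s = c t → G t ≤ G s + h * (t - s) + C)
    (hstep : ∀ s t, 0 < s → s ≤ t → t ≤ s + 1 → G t ≤ G s + h * (t - s) + C)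
    {s t : ℝ} (hs : 0 < s) (hst : s ≤ t) :
    G t ≤ G s + h * (t - s) + 2 * C * Fintype.card ι := by
  classical
  have main : ∀ n : ℕ, ∀ T : Finset ι, T.card = n → ∀ s t : ℝ, 0 < s → s ≤ t →
      (∀ u, s ≤ u → u ≤ t → c u ∈ T) → G t ≤ G s + h * (t - s) + 2 * C * n := by
    intro n
    induction n with
    | zero =>
      intro T hT s t _ hst hc
      rw [Finset.card_eq_zero.mp hT] at hc
      exact absurd (hc s le_rfl hst) (Finset.notMem_empty _)
    | succ n ih =>
      intro T hT s t hs hst hc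
      set A := {u | s ≤ u ∧ u ≤ t ∧ c s = c u} with hA
      have hsA : s ∈ A := ⟨le_rfl, hst, rfl⟩
      have hbdd : BddAbove A := ⟨t, fun u hu => hu.2.1⟩
      -- The last time with the colour of `s` need not exist, so `u` is one within distance `1` of
      -- the supremum. Beyond `u + 1` this colour is used up; each colour costs `C` for the jump and
      -- `C` for the unit step.
      obtain ⟨u, ⟨hsu, hut, hcu⟩, hu⟩ := exists_lt_of_lt_csSup ⟨s, hsA⟩ (sub_one_lt (sSup A))
      have h1 := hcol s u hs hsu hcu
      have hn : 0 ≤ C * n := by positivity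
      push_cast
      rcases le_or_gt t (u + 1) with htu | htu
      · have h2 := hstep u t (hs.trans_le hsu) hut htu
        linarith
      · have h2 := hstep u (u + 1) (hs.trans_le hsu) (by linarith) le_rfl
        have h3 := ih (T.erase (c s))
          (by rw [Finset.card_erase_of_mem (hc s le_rfl hst), hT]; rfl) (u + 1) t
          (by linarith) htu.le fun v hv hvt => by
            refine Finset.mem_erase.mpr ⟨fun hcv => ?_, hc v (by linarith) hvt⟩
            have := le_csSup hbdd (show v ∈ A from ⟨by linarith, hvt, hcv.symm⟩)
            linarith
        linarith
  exact main _ Finset.univ rfl s t hs hst fun _ _ _ => Finset.mem_univ _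

namespace SpongeIFS

variable {d N : ℕ} (S : SpongeIFS d N)

/-! ### Energies at two scales -/

theorem stoppingExp_mono (w : ℕ → Fin N) {s t : ℝ} (hs : 0 < s) (hst : s ≤ t) (k : Fin d) :
    S.stoppingExp w s k ≤ S.stoppingExp w t k := by
  by_contra! h
  obtain ⟨-, h2, -⟩ := S.stopping_spec w (Real.exp_pos (-t))
    (by simpa using hs.trans_le hst) k
  obtain ⟨-, -, h3⟩ := S.stopping_spec w (Real.exp_pos (-s)) (by simpa using hs) k
  have h4 : Real.exp (-t) ≤ Real.exp (-s) := Real.exp_le_exp.mpr (by linarith)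
  have h5 := S.side_anti w k (show S.stoppingExp w t k ≤ S.stoppingExp w s k - 1 by omega)
  simp only [stoppingExp] at h5
  linarith

theorem sum_Ico_neg_log_scale (w : ℕ → Fin N) (k : Fin d) {L L' : ℕ} (h : L ≤ L') :
    ∑ l ∈ Finset.Ico L L', -Real.log (S.scale (w l) k) = S.logSide w L' k - S.logSide w L k :=
  Finset.sum_Ico_eq_sub _ h

section Terms

variable [NeZero N]

/-- The `n`-th summand of `upperSum`. -/
noncomputable def upperTerm (p : Fin N → ℝ) (σ : Equiv.Perm (Fin d)) (n : Fin d) : ℝ :=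
  (S.index σ (n + 1)).sup' (S.index_nonempty σ (n + 1)) fun i =>
    Real.log (S.condProb p σ n i) / Real.log (S.scale i (σ n))

/-- The `n`-th summand of `lowerSum`. -/
noncomputable def lowerTerm (p : Fin N → ℝ) (σ : Equiv.Perm (Fin d)) (n : Fin d) : ℝ :=
  (S.index σ (n + 1)).inf' (S.index_nonempty σ (n + 1)) fun i =>
    Real.log (S.condProb p σ n i) / Real.log (S.scale i (σ n))

variable {p : Fin N → ℝ}

theorem neg_log_letterProb_le (σ : Equiv.Perm (Fin d)) (n : Fin d) (i : Fin N) :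
    -Real.log (S.letterProb p σ n i) ≤ S.upperTerm p σ n * -Real.log (S.scale i (σ n)) := by
  rw [← div_le_iff₀ (S.neg_log_scale_pos i (σ n)), neg_div_neg_eq, letterProb]
  have := Finset.le_sup' (fun i => Real.log (S.condProb p σ n i) / Real.log (S.scale i (σ n)))
    (S.proj_mem_index σ (n + 1) i)
  rwa [scale_proj] at this

theorem le_neg_log_letterProb (σ : Equiv.Perm (Fin d)) (n : Fin d) (i : Fin N) :
    S.lowerTerm p σ n * -Real.log (S.scale i (σ n)) ≤ -Real.log (S.letterProb p σ n i) := by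
  rw [← le_div_iff₀ (S.neg_log_scale_pos i (σ n)), neg_div_neg_eq, letterProb]
  have := Finset.inf'_le (fun i => Real.log (S.condProb p σ n i) / Real.log (S.scale i (σ n)))
    (S.proj_mem_index σ (n + 1) i)
  rwa [scale_proj] at this

theorem exists_upperTerm (p : Fin N → ℝ) (σ : Equiv.Perm (Fin d)) (n : Fin d) :
    ∃ i, -Real.log (S.letterProb p σ n i) = S.upperTerm p σ n * -Real.log (S.scale i (σ n)) := by
  obtain ⟨i, hi, h⟩ := Finset.exists_mem_eq_sup' (S.index_nonempty σ (n + 1)) fun i =>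
    Real.log (S.condProb p σ n i) / Real.log (S.scale i (σ n))
  refine ⟨i, ?_⟩
  rw [← div_eq_iff (S.neg_log_scale_pos i (σ n)).ne', neg_div_neg_eq, letterProb,
    S.proj_eq_self hi, upperTerm, h]

theorem exists_lowerTerm (p : Fin N → ℝ) (σ : Equiv.Perm (Fin d)) (n : Fin d) :
    ∃ i, -Real.log (S.letterProb p σ n i) = S.lowerTerm p σ n * -Real.log (S.scale i (σ n)) := by
  obtain ⟨i, hi, h⟩ := Finset.exists_mem_eq_inf' (S.index_nonempty σ (n + 1)) fun i =>
    Real.log (S.condProb p σ n i) / Real.log (S.scale i (σ n))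
  refine ⟨i, ?_⟩
  rw [← div_eq_iff (S.neg_log_scale_pos i (σ n)).ne', neg_div_neg_eq, letterProb,
    S.proj_eq_self hi, lowerTerm, h]

end Terms

section Energy

variable {p : Fin N → ℝ} (hp : ∀ i, 0 < p i)
include hp

theorem neg_log_letterProb_nonneg (σ : Equiv.Perm (Fin d)) (n : ℕ) (i : Fin N) :
    0 ≤ -Real.log (S.letterProb p σ n i) :=
  neg_nonneg.mpr (Real.log_nonpos (S.letterProb_pos hp _ _ _).le (S.letterProb_le_one hp _ _ _))

theorem lowerTerm_nonneg [NeZero N] (σ : Equiv.Perm (Fin d)) (n : Fin d) :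
    0 ≤ S.lowerTerm p σ n := by
  obtain ⟨i, hi⟩ := S.exists_lowerTerm p σ n
  have h1 := S.neg_log_letterProb_nonneg hp σ n i
  rw [hi] at h1
  exact nonneg_of_mul_nonneg_left h1 (S.neg_log_scale_pos i (σ n))

theorem upperTerm_nonneg [NeZero N] (σ : Equiv.Perm (Fin d)) (n : Fin d) :
    0 ≤ S.upperTerm p σ n := by
  obtain ⟨i, hi⟩ := S.exists_upperTerm p σ n
  have h1 := S.neg_log_letterProb_nonneg hp σ n i
  rw [hi] at h1
  exact nonneg_of_mul_nonneg_left h1 (S.neg_log_scale_pos i (σ n))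

theorem lowerSum_nonneg [NeZero N] (σ : Equiv.Perm (Fin d)) : 0 ≤ S.lowerSum p σ :=
  Finset.sum_nonneg fun n _ => S.lowerTerm_nonneg hp σ n

theorem upperSum_nonneg [NeZero N] (σ : Equiv.Perm (Fin d)) : 0 ≤ S.upperSum p σ :=
  Finset.sum_nonneg fun n _ => S.upperTerm_nonneg hp σ n

variable (hsum : ∑ i, p i = 1)
include hsum

/-- The common ordering is essential: both energies are then expanded in the same conditional
probabilities, and the shared levels cancel. -/
theorem energy_sub_energy (w : ℕ → Fin N) {L L' : Fin d → ℕ} {σ : Equiv.Perm (Fin d)}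
    (hL : Antitone fun n => L (σ n)) (hL' : Antitone fun n => L' (σ n)) (hle : ∀ k, L k ≤ L' k) :
    S.energy p w L' - S.energy p w L = ∑ n : Fin d, ∑ l ∈ Finset.Ico (L (σ n)) (L' (σ n)),
      -Real.log (S.letterProb p σ n (w l)) := by
  rw [S.energy_of_antitone hp hsum w hL, S.energy_of_antitone hp hsum w hL',
    ← Finset.sum_sub_distrib]
  exact Finset.sum_congr rfl fun n _ => (Finset.sum_Ico_eq_sub _ (hle _)).symm

/-- Every letter adds at least a fixed amount to each logarithmic side, so close logarithmic sides
mean close levels and `energy_le_add` applies. No common ordering is needed. -/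
theorem exists_abs_energy_sub_le : ∃ C : ℝ, 0 ≤ C ∧ ∀ (w : ℕ → Fin N) (L L' : Fin d → ℕ) (e : ℝ),
    (∀ k, |S.logSide w (L' k) k - S.logSide w (L k) k| ≤ e) →
      S.energy p w L' ≤ S.energy p w L + C * e := by
  obtain ⟨a, b, ha, -, hab⟩ := S.exists_bounds_log_scale
  rcases isEmpty_or_nonempty (Fin N) with hN | hN
  · exact ⟨0, le_rfl, fun w => hN.elim (w 0)⟩
  obtain ⟨i, hi⟩ := Finite.exists_max fun i => -Real.log (p i)
  have hP : 0 ≤ -Real.log (p i) := by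
    refine neg_nonneg.mpr (Real.log_nonpos (hp i).le ?_)
    rw [← hsum]
    exact Finset.single_le_sum (f := p) (fun j _ => (hp j).le) (Finset.mem_univ _)
  refine ⟨-Real.log (p i) * (d / a), by positivity, fun w L L' e he => ?_⟩
  refine (S.energy_le_add hp hsum hi w L L').trans ?_
  rw [mul_assoc]
  gcongr
  calc ∑ k, |(L' k : ℝ) - L k| ≤ ∑ _k : Fin d, e / a := by
        gcongr with k _
        refine (S.abs_sub_le_of_logSide ha (fun i k => (hab i k).1) w k (L k) (L' k)).trans ?_
        gcongr
        exact he k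
    _ = d / a * e := by
        rw [Finset.sum_const, Finset.card_univ, Fintype.card_fin, nsmul_eq_mul]
        ring

theorem exists_energy_stoppingExp_le : ∃ C : ℝ, 0 ≤ C ∧ ∀ (w : ℕ → Fin N) (s t : ℝ), 0 < s → 0 < t →
    S.energy p w (S.stoppingExp w t) ≤ S.energy p w (S.stoppingExp w s) + C * (|t - s| + 1) := by
  obtain ⟨a, b, -, hb, hab⟩ := S.exists_bounds_log_scale
  obtain ⟨C, hC, h⟩ := S.exists_abs_energy_sub_le hp hsum
  refine ⟨C * (1 + b), by positivity, fun w s t hs ht => ?_⟩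
  refine (h w (S.stoppingExp w s) _ (|t - s| + b) fun k => ?_).trans ?_
  · obtain ⟨h1, h2⟩ := S.logSide_stoppingExp (fun i k => (hab i k).2) w hs k
    obtain ⟨h3, h4⟩ := S.logSide_stoppingExp (fun i k => (hab i k).2) w ht k
    rw [abs_le]
    constructor <;> linarith [le_abs_self (t - s), neg_abs_le (t - s)]
  · rw [mul_assoc]
    gcongr
    nlinarith [abs_nonneg (t - s)]

/-- Serves radii comparable to the diameter, for which the trivial bound `1` on the mass is used at
time `1`. -/
theorem exists_energy_stoppingExp_one_le : ∃ C : ℝ, ∀ w : ℕ → Fin N,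
    S.energy p w (S.stoppingExp w 1) ≤ C := by
  obtain ⟨a, b, -, hb, hab⟩ := S.exists_bounds_log_scale
  obtain ⟨C, hC, h⟩ := S.exists_abs_energy_sub_le hp hsum
  refine ⟨C * (1 + b), fun w => ?_⟩
  have h0 : S.energy p w 0 = 0 := by
    rw [S.energy_eq_sum_range hsum w (L := 0) (M := 0) fun _ => le_rfl]
    simp
  have := h w 0 (S.stoppingExp w 1) (1 + b) fun k => by
    obtain ⟨h3, h4⟩ := S.logSide_stoppingExp (fun i k => (hab i k).2) w one_pos k
    rw [show S.logSide w ((0 : Fin d → ℕ) k) k = 0 by simp [logSide], sub_zero,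
      abs_of_nonneg (by linarith)]
    exact h4
  linarith

/-- The energy grows at most at rate `h` if all the upper sums are at most `h`. -/
theorem exists_energy_le_add_mul [NeZero N] {h : ℝ} (hh : ∀ σ ∈ S.cubeOrders, S.upperSum p σ ≤ h) :
    ∃ C : ℝ, 0 ≤ C ∧ ∀ (w : ℕ → Fin N) (s t : ℝ), 0 < s → s ≤ t →
      S.energy p w (S.stoppingExp w t) ≤ S.energy p w (S.stoppingExp w s) + h * (t - s) + C := by
  obtain ⟨a, b, -, hb, hab⟩ := S.exists_bounds_log_scale
  obtain ⟨C, hC, hstep⟩ := S.exists_energy_stoppingExp_le hp hsum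
  have hh0 : 0 ≤ h := by
    obtain ⟨σ, hσ, -⟩ := S.exists_cubeOrder (fun _ => 0) one_pos
    exact (S.upperSum_nonneg hp σ).trans (hh σ hσ)
  refine ⟨2 * (2 * C + h * b) * Fintype.card (Equiv.Perm (Fin d)), by positivity,
    fun w s t hs hst => ?_⟩
  -- The colour of a time is an ordering in `𝓐` of the cube at that scale.
  choose! c hcA hc using fun (t : ℝ) (ht : 0 < t) => S.exists_cubeOrder w ht
  refine le_add_mul_of_finite_coloring c (fun t => S.energy p w (S.stoppingExp w t))
    (by positivity) ?_ ?_ hs hst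
  · intro s t hs hst hcol
    have hcs := hc s hs
    rw [hcol] at hcs
    have h1 := S.energy_sub_energy hp hsum w hcs (hc t (hs.trans_le hst))
      (S.stoppingExp_mono w hs hst)
    have h2 : ∀ n : Fin d, ∑ l ∈ Finset.Ico (S.stoppingExp w s (c t n)) (S.stoppingExp w t (c t n)),
        -Real.log (S.letterProb p (c t) n (w l)) ≤ S.upperTerm p (c t) n * (t - s + b) := by
      intro n
      refine (Finset.sum_le_sum fun l _ => S.neg_log_letterProb_le (c t) n (w l)).trans ?_
      rw [← Finset.mul_sum, S.sum_Ico_neg_log_scale w _ (S.stoppingExp_mono w hs hst _)]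
      refine mul_le_mul_of_nonneg_left ?_ (S.upperTerm_nonneg hp _ n)
      have h3 := (S.logSide_stoppingExp (fun i k => (hab i k).2) w hs (c t n)).1
      have h4 := (S.logSide_stoppingExp (fun i k => (hab i k).2) w (hs.trans_le hst) (c t n)).2
      linarith
    have h3 := Finset.sum_le_sum fun n (_ : n ∈ Finset.univ) => h2 n
    rw [← h1, ← Finset.sum_mul] at h3
    have h4 : (∑ n, S.upperTerm p (c t) n) * (t - s + b) ≤ h * (t - s + b) :=
      mul_le_mul_of_nonneg_right (hh _ (hcA t (hs.trans_le hst))) (by linarith)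
    linarith
  · intro s t hs hst hst1
    have h1 := hstep w s t hs (hs.trans_le hst)
    rw [abs_of_nonneg (by linarith)] at h1
    have h2 : C * (t - s + 1) ≤ C * 2 := by
      gcongr
      linarith
    have h3 : 0 ≤ h * (t - s) := mul_nonneg hh0 (by linarith)
    have h4 : 0 ≤ h * b := by positivity
    linarith

/-- The energy grows at least at rate `h` if all the lower sums are at least `h`. -/
theorem exists_add_mul_le_energy [NeZero N] {h : ℝ} (hh : ∀ σ ∈ S.cubeOrders, h ≤ S.lowerSum p σ)
    (hh0 : 0 ≤ h) :
    ∃ C : ℝ, 0 ≤ C ∧ ∀ (w : ℕ → Fin N) (s t : ℝ), 0 < s → s ≤ t →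
      S.energy p w (S.stoppingExp w s) + h * (t - s) ≤ S.energy p w (S.stoppingExp w t) + C := by
  obtain ⟨a, b, -, hb, hab⟩ := S.exists_bounds_log_scale
  obtain ⟨C, hC, hstep⟩ := S.exists_energy_stoppingExp_le hp hsum
  -- The overshoot `b` of the stopping levels is multiplied by a lower sum, which therefore needs a
  -- uniform upper bound.
  obtain ⟨M, hM⟩ : ∃ M, ∀ σ : Equiv.Perm (Fin d), S.lowerSum p σ ≤ M :=
    (Set.finite_range fun σ => S.lowerSum p σ).bddAbove.imp fun M hM σ => hM ⟨σ, rfl⟩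
  have hM0 : 0 ≤ M := (S.lowerSum_nonneg hp 1).trans (hM 1)
  refine ⟨2 * (2 * C + h + M * b) * Fintype.card (Equiv.Perm (Fin d)), by positivity,
    fun w s t hs hst => ?_⟩
  choose! c hcA hc using fun (t : ℝ) (ht : 0 < t) => S.exists_cubeOrder w ht
  -- A lower growth rate of the energy is an upper one, `-h`, of its negative.
  have key := le_add_mul_of_finite_coloring c (fun t => -S.energy p w (S.stoppingExp w t))
    (h := -h) (C := 2 * C + h + M * b) (by positivity) ?_ ?_ hs hst
  · linarith
  · intro s t hs hst hcol
    have hcs := hc s hs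
    rw [hcol] at hcs
    have h1 := S.energy_sub_energy hp hsum w hcs (hc t (hs.trans_le hst))
      (S.stoppingExp_mono w hs hst)
    have h2 : ∀ n : Fin d, S.lowerTerm p (c t) n * (t - s - b) ≤
        ∑ l ∈ Finset.Ico (S.stoppingExp w s (c t n)) (S.stoppingExp w t (c t n)),
        -Real.log (S.letterProb p (c t) n (w l)) := by
      intro n
      refine le_trans ?_ (Finset.sum_le_sum fun l _ => S.le_neg_log_letterProb (c t) n (w l))
      rw [← Finset.mul_sum, S.sum_Ico_neg_log_scale w _ (S.stoppingExp_mono w hs hst _)]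
      refine mul_le_mul_of_nonneg_left ?_ (S.lowerTerm_nonneg hp _ n)
      have h3 := (S.logSide_stoppingExp (fun i k => (hab i k).2) w hs (c t n)).2
      have h4 := (S.logSide_stoppingExp (fun i k => (hab i k).2) w (hs.trans_le hst) (c t n)).1
      linarith
    have h3 := Finset.sum_le_sum fun n (_ : n ∈ Finset.univ) => h2 n
    rw [← h1, ← Finset.sum_mul] at h3
    have h4 : h * (t - s) ≤ (∑ n, S.lowerTerm p (c t) n) * (t - s) :=
      mul_le_mul_of_nonneg_right (hh _ (hcA t (hs.trans_le hst))) (by linarith)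
    have h5 : (∑ n, S.lowerTerm p (c t) n) * b ≤ M * b :=
      mul_le_mul_of_nonneg_right (hM (c t)) hb.le
    linarith
  · intro s t hs hst hst1
    have h1 := hstep w t s (hs.trans_le hst) hs
    rw [abs_sub_comm, abs_of_nonneg (by linarith)] at h1
    have h2 : C * (t - s + 1) ≤ C * 2 := by
      gcongr
      linarith
    have h3 : h * (t - s) ≤ h * 1 := by
      gcongr
      linarith
    have h4 : 0 ≤ M * b := by positivity
    linarith

theorem exp_neg_energy (w : ℕ → Fin N) {L : Fin d → ℕ} {M : ℕ} (hM : ∀ k, L k ≤ M) :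
    Real.exp (-S.energy p w L) = ∏ l ∈ Finset.range M,
      S.agreeProb p (Finset.univ.filter fun k => l < L k) (w l) := by
  rw [S.energy_eq_sum_range hsum w hM, ← Finset.sum_neg_distrib, Real.exp_sum]
  refine Finset.prod_congr rfl fun l _ => ?_
  rw [neg_neg, Real.exp_log (S.agreeProb_pos hp _ _)]

end Energy

/-! ### Separation -/

theorem exists_gap : ∃ δ : ℝ, 0 < δ ∧ δ ≤ 1 ∧ ∀ i j k,
    S.scale i k + S.trans i k < S.trans j k → δ ≤ S.trans j k - (S.scale i k + S.trans i k) := by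
  classical
  set f : Fin N × Fin N × Fin d → ℝ := fun x =>
    S.trans x.2.1 x.2.2 - (S.scale x.1 x.2.2 + S.trans x.1 x.2.2)
  -- Nonpositive gaps are replaced by `1`, so that the minimum over the finite type is positive.
  set g : Fin N × Fin N × Fin d → ℝ := fun x => if 0 < f x then f x else 1 with hg
  have hpos : ∀ x, 0 < g x := fun x => by
    simp only [hg]
    split_ifs with h
    · exact h
    · exact one_pos
  obtain ⟨δ, hδ0, hδ⟩ : ∃ δ : ℝ, 0 < δ ∧ ∀ x, δ ≤ g x := by
    rcases isEmpty_or_nonempty (Fin N × Fin N × Fin d) with h | h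
    · exact ⟨1, one_pos, fun x => h.elim x⟩
    · obtain ⟨x, hx⟩ := Finite.exists_min g
      exact ⟨g x, hpos x, hx⟩
  refine ⟨min δ 1, lt_min hδ0 one_pos, min_le_right _ _, fun i j k hlt => ?_⟩
  have h1 := hδ (i, j, k)
  have h2 : 0 < f (i, j, k) := sub_pos.mpr hlt
  simp only [hg, if_pos h2] at h1
  exact (min_le_left _ _).trans h1

/-- Boxes whose intervals meet in every coordinate have a common point, namely the one whose
coordinates are the larger left endpoints. -/
theorem exists_separated_coord {σ : Equiv.Perm (Fin d)} {n : ℕ} {i j : Fin N}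
    (h : Disjoint (coordProj σ n '' (S.map i '' unitCube d))
      (coordProj σ n '' (S.map j '' unitCube d))) :
    ∃ k ∈ initialCoords σ n, S.scale i k + S.trans i k < S.trans j k ∨
      S.scale j k + S.trans j k < S.trans i k := by
  by_contra! hcon
  set z : Fin d → ℝ := fun k => max (S.trans i k) (S.trans j k) with hz
  set pt : Fin N → EuclideanSpace ℝ (Fin d) := fun i' => WithLp.toLp 2 fun k =>
    if (σ.symm k : ℕ) < n then (z k - S.trans i' k) / S.scale i' k else 0 with hpt
  have hmem : ∀ i', (∀ k, (σ.symm k : ℕ) < n → S.trans i' k ≤ z k ∧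
      z k ≤ S.scale i' k + S.trans i' k) → pt i' ∈ unitCube d := by
    intro i' hi' k
    simp only [hpt]
    split_ifs with hk
    · have := S.scale_pos i' k
      obtain ⟨h1, h2⟩ := hi' k hk
      exact ⟨div_nonneg (by linarith) this.le, (div_le_one this).mpr (by linarith)⟩
    · simp
  have hval : ∀ i', coordProj σ n (S.map i' (pt i')) =
      WithLp.toLp 2 fun k => if (σ.symm k : ℕ) < n then z k else 0 := by
    intro i'
    ext k
    simp only [coordProj, map_apply, hpt]
    split_ifs with hk
    · rw [mul_div_cancel₀ _ (S.scale_pos i' k).ne']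
      ring
    · rfl
  refine Set.disjoint_left.mp h ⟨_, ⟨pt i, hmem i ?_, rfl⟩, rfl⟩
    ⟨_, ⟨pt j, hmem j ?_, rfl⟩, (hval j).trans (hval i).symm⟩
  · intro k hk
    have := hcon k (mem_initialCoords.mpr hk)
    exact ⟨le_max_left _ _, max_le (by linarith [S.scale_pos i k]) this.1⟩
  · intro k hk
    have := hcon k (mem_initialCoords.mpr hk)
    exact ⟨le_max_right _ _, max_le this.2 (by linarith [S.scale_pos j k])⟩

/-- Letters not agreeing in the coordinates which are active at some scale are separated. -/
theorem exists_separation (hS : S.VeryStrongSPPC) : ∃ δ : ℝ, 0 < δ ∧ δ ≤ 1 ∧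
    ∀ (w : ℕ → Fin N) (t : ℝ), 0 < t → ∀ (l : ℕ) (j : Fin N),
      ¬ S.AgreeOn (Finset.univ.filter fun k => l < S.stoppingExp w t k) (w l) j →
      ∃ k, l < S.stoppingExp w t k ∧ ∀ x ∈ unitCube d, ∀ y ∈ unitCube d,
        δ ≤ |S.map (w l) x k - S.map j y k| := by
  obtain ⟨δ, hδ, hδ1, hgap⟩ := S.exists_gap
  refine ⟨δ, hδ, hδ1, fun w t ht l j hj => ?_⟩
  obtain ⟨σ, hσ, hL⟩ := S.exists_cubeOrder w ht
  obtain ⟨m, hmd, hset, -⟩ := exists_filter_eq_initialCoords hL l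
  -- With no active coordinate all letters agree, so the separation condition is only needed on
  -- nonzero subspaces.
  have hm : 1 ≤ m := by
    by_contra! h
    rw [hset] at hj
    exact hj fun k hk => absurd (mem_initialCoords.mp hk) (by omega)
  rcases hS σ hσ m hm hmd (w l) j with h | h
  · rw [overlap_iff_agreeOn, ← hset] at h
    exact absurd h hj
  · obtain ⟨k, hk, hsep⟩ := S.exists_separated_coord h
    rw [← hset, Finset.mem_filter] at hk
    refine ⟨k, hk.2, fun x hx y hy => ?_⟩
    rw [map_apply, map_apply]
    have h1 := S.scale_pos (w l) k
    have h2 := S.scale_pos j k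
    have hx1 := mul_le_mul_of_nonneg_left (hx k).1 h1.le
    have hx2 := mul_le_mul_of_nonneg_left (hx k).2 h1.le
    have hy1 := mul_le_mul_of_nonneg_left (hy k).1 h2.le
    have hy2 := mul_le_mul_of_nonneg_left (hy k).2 h2.le
    rcases hsep with hlt | hlt
    · have := hgap _ _ _ hlt
      rw [abs_sub_comm]
      exact le_trans (by linarith) (le_abs_self _)
    · have := hgap _ _ _ hlt
      exact le_trans (by linarith) (le_abs_self _)

end SpongeIFS

namespace SpongeIFS

variable {d N : ℕ} {S : SpongeIFS d N}

/-! ### Balls and symbolic cubes -/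

namespace IsSelfAffineMeasure

variable {p : Fin N → ℝ} {ν : Measure (EuclideanSpace ℝ (Fin d))}
  (hν : S.IsSelfAffineMeasure p ν) (hp : ∀ i, 0 < p i) (hsum : ∑ i, p i = 1)
include hν hp hsum

/-- At the first level `l` where a word leaves the cube, the letters are `δ`-separated in some
active coordinate `k`. The two words have the same cylinder in coordinate `k` up to level `l`, whose
side still exceeds `exp (-t)`, so the points are at least `δ * exp (-t)` apart. -/
theorem exists_real_closedBall_le (hS : S.VeryStrongSPPC) : ∃ δ : ℝ, 0 < δ ∧ δ ≤ 1 ∧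
    ∀ (w : ℕ → Fin N) (x : EuclideanSpace ℝ (Fin d)), (∀ L, ∃ y ∈ ν.support, x = S.cyl w L y) →
      ∀ t ρ : ℝ, 0 < t → ρ < δ * Real.exp (-t) →
        ν.real (Metric.closedBall x ρ) ≤ Real.exp (-S.energy p w (S.stoppingExp w t)) := by
  classical
  obtain ⟨δ, hδ, hδ1, hsep⟩ := S.exists_separation hS
  have hcube := hν.support_subset_unitCube hp hsum
  refine ⟨δ, hδ, hδ1, fun w x hx t ρ ht hρ => ?_⟩
  rw [S.exp_neg_energy hp hsum w (M := Finset.univ.sup (S.stoppingExp w t))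
    fun k => Finset.le_sup (Finset.mem_univ k)]
  refine hν.real_le_prod hp hsum Metric.isClosed_closedBall.measurableSet _ (fun l =>
    Finset.univ.filter fun j =>
      S.AgreeOn (Finset.univ.filter fun k => l < S.stoppingExp w t k) (w l) j) ?_
  intro v z hz hball l
  induction l using Nat.strong_induction_on with
  | _ l ih =>
    intro hl
    by_contra hcon
    simp only [Finset.mem_filter, Finset.mem_univ, true_and] at hcon
    obtain ⟨k, hk, hsepk⟩ := hsep w t ht l (v l) hcon
    obtain ⟨y, hy, hxy⟩ := hx (l + 1)
    obtain ⟨z', hz', hvz⟩ := S.exists_cyl_eq (w := v) hl (hcube hz)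
    -- A coordinate active at level `l` is active at all earlier levels, where the words agree by
    -- induction.
    have hagree : ∀ l' < l, S.scale (w l') k = S.scale (v l') k ∧
        S.trans (w l') k = S.trans (v l') k := by
      intro l' hl'
      have := ih l' hl' (hl'.trans hl)
      simp only [Finset.mem_filter, Finset.mem_univ, true_and] at this
      exact this k (by simpa using hl'.trans hk)
    have hside : ∀ l' ≤ l, S.side w l' k = S.side v l' k := fun l' hl' =>
      Finset.prod_congr rfl fun m hm => (hagree m ((Finset.mem_range.mp hm).trans_le hl')).1
    have hdiff : x k - S.cyl v (Finset.univ.sup (S.stoppingExp w t)) z k =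
        S.side w l k * (S.map (w l) y k - S.map (v l) z' k) := by
      rw [hxy, cyl_succ, hvz, cyl_apply, cyl_apply, ← hside l le_rfl,
        Finset.sum_congr rfl fun m hm => by
          rw [(hagree m (Finset.mem_range.mp hm)).2, hside m (Finset.mem_range.mp hm).le]]
      ring
    have h1 := (abs_sub_le_dist x (S.cyl v (Finset.univ.sup (S.stoppingExp w t)) z) k).trans
      (Metric.mem_closedBall'.mp hball)
    rw [hdiff, abs_mul, abs_of_pos (S.side_pos w l k)] at h1
    have h2 := hsepk y (hcube hy) z' hz'
    obtain ⟨-, -, h3⟩ := S.stopping_spec w (Real.exp_pos (-t)) (by simpa using ht) k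
    have h4 := S.side_anti w k (show l ≤ S.stopping w (Real.exp (-t)) k - 1 by
      unfold stoppingExp at hk
      omega)
    simp only at h4
    have h5 : δ * Real.exp (-t) ≤ S.side w l k * |S.map (w l) y k - S.map (v l) z' k| := by
      rw [mul_comm]
      exact mul_le_mul (by linarith) h2 hδ.le (S.side_pos w l k).le
    linarith

/-- Words of the cube share with `w` the cylinder in coordinate `k` up to its stopping level, whose
side is at most `exp (-t)`. No separation is needed. -/
theorem le_real_closedBall {w : ℕ → Fin N} {x : EuclideanSpace ℝ (Fin d)}
    (hx : ∀ L, ∃ y ∈ ν.support, x = S.cyl w L y) {t ρ : ℝ} (ht : 0 < t)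
    (hρ : d * Real.exp (-t) ≤ ρ) :
    Real.exp (-S.energy p w (S.stoppingExp w t)) ≤ ν.real (Metric.closedBall x ρ) := by
  classical
  have hcube := hν.support_subset_unitCube hp hsum
  set M := Finset.univ.sup (S.stoppingExp w t) with hM
  rw [S.exp_neg_energy hp hsum w (M := M) fun k => Finset.le_sup (Finset.mem_univ k)]
  refine hν.prod_le_real hp hsum Metric.isClosed_closedBall.measurableSet M (fun l =>
    Finset.univ.filter fun j =>
      S.AgreeOn (Finset.univ.filter fun k => l < S.stoppingExp w t k) (w l) j) ?_
  intro v hv z hz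
  rw [Metric.mem_closedBall']
  refine (dist_le_of_forall_abs_sub_le fun k => ?_).trans hρ
  have hkM : S.stoppingExp w t k ≤ M := Finset.le_sup (Finset.mem_univ k)
  have hagree : ∀ l < S.stoppingExp w t k, S.scale (w l) k = S.scale (v l) k ∧
      S.trans (w l) k = S.trans (v l) k := by
    intro l hl
    have := hv l (hl.trans_le hkM)
    simp only [Finset.mem_filter, Finset.mem_univ, true_and] at this
    exact this k (by simpa using hl)
  have hside : ∀ l ≤ S.stoppingExp w t k, S.side w l k = S.side v l k := fun l hl =>
    Finset.prod_congr rfl fun m hm => (hagree m ((Finset.mem_range.mp hm).trans_le hl)).1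
  obtain ⟨y, hy, hxy⟩ := hx (S.stoppingExp w t k)
  obtain ⟨z', hz', hvz⟩ : ∃ z' ∈ unitCube d,
      S.cyl v M z = S.cyl v (S.stoppingExp w t k) z' := by
    rcases hkM.lt_or_eq with h | h
    · obtain ⟨z', hz', h'⟩ := S.exists_cyl_eq (w := v) h hz
      exact ⟨_, S.map_mem_unitCube _ hz', h'⟩
    · exact ⟨z, hz, by rw [h]⟩
  have hdiff : x k - S.cyl v M z k = S.side w (S.stoppingExp w t k) k * (y k - z' k) := by
    rw [hvz, cyl_apply, ← hside _ le_rfl]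
    nth_rewrite 1 [hxy]
    rw [cyl_apply, Finset.sum_congr rfl fun m hm => by
      rw [(hagree m (Finset.mem_range.mp hm)).2, hside m (Finset.mem_range.mp hm).le]]
    ring
  obtain ⟨-, h2, -⟩ := S.stopping_spec w (Real.exp_pos (-t)) (by simpa using ht) k
  rw [hdiff, abs_mul, abs_of_pos (S.side_pos _ _ _), ← mul_one (Real.exp (-t))]
  refine mul_le_mul h2 ?_ (abs_nonneg _) (Real.exp_pos _).le
  have h3 := hcube hy k
  have h4 := hz' k
  exact abs_sub_le_iff.mpr ⟨by linarith, by linarith⟩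

theorem diam_support_le : Metric.diam ν.support ≤ d := by
  refine Metric.diam_le_of_forall_dist_le (Nat.cast_nonneg d) fun x hx y hy => ?_
  have h := dist_le_of_forall_abs_sub_le (x := x) (y := y) (r := 1) fun k => ?_
  · simpa using h
  have h1 := hν.support_subset_unitCube hp hsum hx k
  have h2 := hν.support_subset_unitCube hp hsum hy k
  exact abs_sub_le_iff.mpr ⟨by linarith, by linarith⟩

/-- Masses of balls in terms of energies, for all radii up to the diameter of the support. -/
theorem exists_real_closedBall_bounds (hS : S.VeryStrongSPPC) : ∃ C : ℝ, 0 ≤ C ∧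
    ∀ x ∈ ν.support, ∃ w : ℕ → Fin N, ∀ ρ : ℝ, 0 < ρ → ρ < Metric.diam ν.support →
      ∃ s t : ℝ, 0 < s ∧ 0 < t ∧ |s + Real.log ρ| ≤ C ∧ |t + Real.log ρ| ≤ C ∧ s ≤ t ∧
        ν.real (Metric.closedBall x ρ) ≤ Real.exp (C - S.energy p w (S.stoppingExp w s)) ∧
        Real.exp (-S.energy p w (S.stoppingExp w t)) ≤ ν.real (Metric.closedBall x ρ) := by
  have := hν.isProbabilityMeasure
  obtain ⟨δ, hδ, hδ1, hball⟩ := hν.exists_real_closedBall_le hp hsum hS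
  obtain ⟨C1, hC1⟩ := S.exists_energy_stoppingExp_one_le hp hsum
  have hlogδ : Real.log δ ≤ 0 := Real.log_nonpos hδ.le hδ1
  have hlogd : 0 ≤ Real.log d := Real.log_natCast_nonneg d
  refine ⟨|C1| + 1 - Real.log δ + 1 + Real.log d, by linarith [abs_nonneg C1], fun x hx => ?_⟩
  obtain ⟨w, hw⟩ := hν.exists_code hp hsum hx
  refine ⟨w, fun ρ hρ hρd => ?_⟩
  have hρd' := hρd.trans_le (hν.diam_support_le hp hsum)
  have hd : (0 : ℝ) < d := hρ.trans hρd'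
  have hlog : Real.log ρ < Real.log d := Real.log_lt_log hρ hρd'
  have habs := abs_nonneg C1
  -- Unless the maximum is `1`, these times give `δ * exp (-s) = e * ρ`; always `d * exp (-t) = ρ /
  -- e`. If `s = 1`, the energy is bounded and the upper bound is trivial.
  refine ⟨max (Real.log δ - Real.log ρ - 1) 1, Real.log d - Real.log ρ + 1, by positivity,
    by linarith, ?_, ?_, max_le (by linarith) (by linarith), ?_, ?_⟩
  · rcases le_total (Real.log δ - Real.log ρ - 1) 1 with h | h
    · rw [max_eq_right h, abs_le]
      constructor <;> linarith
    · rw [max_eq_left h, abs_le]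
      constructor <;> linarith
  · rw [abs_le]
    constructor <;> linarith
  · rcases le_total (Real.log δ - Real.log ρ - 1) 1 with h | h
    · rw [max_eq_right h]
      refine measureReal_le_one.trans (Real.one_le_exp ?_)
      have := hC1 w
      have := le_abs_self C1
      linarith
    · rw [max_eq_left h]
      refine (hball w x hw (Real.log δ - Real.log ρ - 1) ρ (by linarith) ?_).trans (Real.exp_le_exp.mpr (by linarith))
      rw [← Real.log_lt_log_iff hρ (by positivity), Real.log_mul hδ.ne' (Real.exp_pos _).ne',
        Real.log_exp]
      linarith
  · refine hν.le_real_closedBall hp hsum hw (by linarith) ?_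
    rw [← Real.log_le_log_iff (by positivity) hρ, Real.log_mul hd.ne' (Real.exp_pos _).ne',
      Real.log_exp]
    linarith

omit hν hp hsum in
theorem mul_div_rpow {R r s C : ℝ} (hr : 0 < r) (hR : 0 < R) :
    Real.exp C * (R / r) ^ s = Real.exp (C + s * (Real.log R - Real.log r)) := by
  rw [Real.rpow_def_of_pos (div_pos hR hr), Real.log_div hR.ne' hr.ne', ← Real.exp_add]
  ring_nf

theorem assouadDim_le [NeZero N] (hS : S.VeryStrongSPPC) {h : ℝ}
    (hh : ∀ σ ∈ S.cubeOrders, S.upperSum p σ ≤ h) : assouadDim ν ≤ h := by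
  have hh0 : 0 ≤ h := by
    obtain ⟨σ, hσ, -⟩ := S.exists_cubeOrder (fun _ => 0) one_pos
    exact (S.upperSum_nonneg hp σ).trans (hh σ hσ)
  obtain ⟨C, hC, hball⟩ := hν.exists_real_closedBall_bounds hp hsum hS
  obtain ⟨C', hC', hgrow⟩ := S.exists_energy_le_add_mul hp hsum hh
  obtain ⟨C'', hC'', hstep⟩ := S.exists_energy_stoppingExp_le hp hsum
  refine sInf_le ⟨h, rfl, hh0, Real.exp (C + C' + h * (2 * C) + C'' * (2 * C + 1)), Real.exp_pos _,
    fun x hx r R hr hrR hR => ?_⟩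
  obtain ⟨w, hw⟩ := hball x hx
  obtain ⟨s, -, hs, -, hsR, -, -, hup, -⟩ := hw R (hr.trans hrR) hR
  obtain ⟨-, t, -, ht, -, htr, -, -, hlow⟩ := hw r hr (hrR.trans hR)
  have hlog : Real.log r < Real.log R := Real.log_lt_log hr hrR
  rw [abs_le] at hsR htr
  rw [mul_div_rpow hr (hr.trans hrR), div_le_iff₀ (lt_of_lt_of_le (Real.exp_pos _) hlow)]
  refine hup.trans ?_
  refine le_trans ?_ (mul_le_mul_of_nonneg_left hlow (Real.exp_pos _).le)
  rw [← Real.exp_add, Real.exp_le_exp]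
  have hC2 : 0 ≤ C'' * (2 * C + 1) := by positivity
  -- The two times approximate `-log R` and `-log r` only up to `C`. If they are in the wrong order
  -- they differ by at most `2 * C`, and the Lipschitz bound on the energy suffices.
  rcases le_total s t with hst | hst
  · have h1 := hgrow w s t hs hst
    have h2 : h * (t - s) ≤ h * (Real.log R - Real.log r + 2 * C) := by
      gcongr
      linarith
    linarith
  · have h1 := hstep w s t hs ht
    have h2 : C'' * (|t - s| + 1) ≤ C'' * (2 * C + 1) := by
      gcongr
      exact abs_le.mpr ⟨by linarith, by linarith⟩
    have h3 : 0 ≤ h * (Real.log R - Real.log r) := mul_nonneg hh0 (by linarith)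
    have h4 : 0 ≤ h * (2 * C) := by positivity
    linarith

theorem le_lowerDim [NeZero N] (hS : S.VeryStrongSPPC) (hdiam : Metric.diam ν.support ≠ 0) {h : ℝ}
    (hh : ∀ σ ∈ S.cubeOrders, h ≤ S.lowerSum p σ) (hh0 : 0 ≤ h) : (h : EReal) ≤ lowerDim ν := by
  rw [lowerDim, if_neg hdiam]
  obtain ⟨C, hC, hball⟩ := hν.exists_real_closedBall_bounds hp hsum hS
  obtain ⟨C', hC', hgrow⟩ := S.exists_add_mul_le_energy hp hsum hh hh0
  obtain ⟨C'', hC'', hstep⟩ := S.exists_energy_stoppingExp_le hp hsum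
  refine le_sSup ⟨h, rfl, hh0, Real.exp (-(C + C' + h * (2 * C) + C'' * (2 * C + 1))),
    Real.exp_pos _, fun x hx r R hr hrR hR => ?_⟩
  obtain ⟨w, hw⟩ := hball x hx
  obtain ⟨-, s, -, hs, -, hsR, -, -, hlow⟩ := hw R (hr.trans hrR) hR
  obtain ⟨t, t', ht, -, htr, -, -, hup, hpos⟩ := hw r hr (hrR.trans hR)
  have hlog : Real.log r < Real.log R := Real.log_lt_log hr hrR
  rw [abs_le] at hsR htr
  rw [mul_div_rpow hr (hr.trans hrR), le_div_iff₀ (lt_of_lt_of_le (Real.exp_pos _) hpos)]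
  refine (mul_le_mul_of_nonneg_left hup (Real.exp_pos _).le).trans (le_trans ?_ hlow)
  rw [← Real.exp_add, Real.exp_le_exp]
  have hC2 : 0 ≤ C'' * (2 * C + 1) := by positivity
  -- For radii close to each other the times may be in the wrong order; then `log (R / r)` and their
  -- distance are both at most `2 * C`.
  rcases le_total s t with hst | hst
  · have h1 := hgrow w s t hs hst
    have h2 : h * (Real.log R - Real.log r - 2 * C) ≤ h * (t - s) :=
      mul_le_mul_of_nonneg_left (by linarith) hh0
    linarith
  · have h1 := hstep w t s ht hs
    have h2 : C'' * (|s - t| + 1) ≤ C'' * (2 * C + 1) := by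
      gcongr
      exact abs_le.mpr ⟨by linarith, by linarith⟩
    have h3 : h * (Real.log R - Real.log r) ≤ h * (2 * C) := by
      gcongr
      linarith
    linarith

end IsSelfAffineMeasure

end SpongeIFS

/-- Turns inequalities with bounded error over arbitrarily long time intervals into inequalities
between rates. -/
theorem le_of_forall_mul_le_mul_add {a b c T₀ : ℝ} (h : ∀ T, T₀ < T → a * T ≤ b * T + c) :
    a ≤ b := by
  by_contra! hab
  have hab' : 0 < a - b := sub_pos.mpr hab
  set T := max (T₀ + 1) ((c + 1) / (a - b))
  have h1 := h T (lt_of_lt_of_le (lt_add_one T₀) (le_max_left _ _))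
  have h2 : (c + 1) / (a - b) ≤ T := le_max_right _ _
  rw [div_le_iff₀ hab'] at h2
  linarith

namespace SpongeIFS

variable {d N : ℕ} (S : SpongeIFS d N)

/-! ### Finite words -/

/-- Minus the logarithm of the side in the coordinate `k` of the cylinder of a finite word. -/
noncomputable def listLogSide (u : List (Fin N)) (k : Fin d) : ℝ :=
  (u.map fun i => -Real.log (S.scale i k)).sum

@[simp]
theorem listLogSide_nil (k : Fin d) : S.listLogSide [] k = 0 := rfl

@[simp]
theorem listLogSide_append (u v : List (Fin N)) (k : Fin d) :
    S.listLogSide (u ++ v) k = S.listLogSide u k + S.listLogSide v k := by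
  simp [listLogSide]

@[simp]
theorem listLogSide_replicate (m : ℕ) (i : Fin N) (k : Fin d) :
    S.listLogSide (List.replicate m i) k = m * -Real.log (S.scale i k) := by
  simp [listLogSide]

@[simp]
theorem listLogSide_flatten_replicate (m : ℕ) (u : List (Fin N)) (k : Fin d) :
    S.listLogSide (List.replicate m u).flatten k = m * S.listLogSide u k := by
  induction m with
  | zero => simp
  | succ m ih =>
    rw [List.replicate_succ, List.flatten_cons, listLogSide_append, ih]
    push_cast
    ring

theorem listLogSide_nonneg (u : List (Fin N)) (k : Fin d) : 0 ≤ S.listLogSide u k := by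
  refine List.sum_nonneg fun x hx => ?_
  obtain ⟨i, -, rfl⟩ := List.mem_map.mp hx
  exact (S.neg_log_scale_pos i k).le

theorem listLogSide_pos {u : List (Fin N)} (hu : u ≠ []) (k : Fin d) : 0 < S.listLogSide u k := by
  obtain ⟨i, v, rfl⟩ := List.exists_cons_of_ne_nil hu
  have h1 := S.neg_log_scale_pos i k
  have h2 := S.listLogSide_nonneg v k
  have h3 : S.listLogSide (i :: v) k = -Real.log (S.scale i k) + S.listLogSide v k := rfl
  linarith

theorem logSide_eq_listLogSide [NeZero N] (u v : List (Fin N)) (k : Fin d) :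
    S.logSide (fun l => (u ++ v).getD l 0) u.length k = S.listLogSide u k := by
  induction u using List.reverseRecOn generalizing v with
  | nil => rfl
  | append_singleton u i ih =>
    have h := ih (i :: v)
    rw [List.append_cons] at h
    rw [List.length_append, List.length_singleton, logSide_succ, h, listLogSide_append]
    simp [listLogSide]

theorem listLogSide_map_range (w : ℕ → Fin N) (L : ℕ) (k : Fin d) :
    S.listLogSide ((List.range L).map w) k = S.logSide w L k := by
  induction L with
  | zero => rfl
  | succ L ih =>
    rw [List.range_succ, List.map_append, listLogSide_append, ih, logSide_succ]
    simp [listLogSide]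

/-- An ordering in `𝓑` is witnessed by a finite word. -/
theorem exists_list_of_mem_cylinderOrders [NeZero d] {σ : Equiv.Perm (Fin d)}
    (hσ : σ ∈ S.cylinderOrders) :
    ∃ u : List (Fin N), u ≠ [] ∧ StrictMono fun n => S.listLogSide u (σ n) := by
  obtain ⟨w, r, h0, h1, h⟩ := hσ
  set L := S.stopping w r (σ ⟨d - 1, Nat.sub_one_lt (NeZero.ne d)⟩)
  have hL : 1 ≤ L := (S.stopping_spec w h0 h1 _).1
  refine ⟨(List.range L).map w, ?_, fun m n hmn => ?_⟩
  · rw [Ne, List.map_eq_nil_iff, List.range_eq_nil]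
    omega
  · have := h hmn
    simp only [side_eq_exp, Real.exp_lt_exp, neg_lt_neg_iff] at this
    simpa only [listLogSide_map_range] using this

/-! ### Words with prescribed zones -/

section Zones

variable (κ : ℕ → Fin d) (u : List (Fin N)) (i : ℕ → Fin N) (T : ℕ → ℕ) (τ : ℝ)

/-- The number of copies of `u` to be appended to `P` so that the logarithmic side in the
coordinate `κ e` gets close to `τ`. -/
noncomputable def fillCount (P : List (Fin N)) (e : ℕ) : ℕ :=
  ⌊(τ - S.listLogSide P (κ e)) / S.listLogSide u (κ e)⌋₊

/-- Fill `P` with copies of `u` until the logarithmic side in the coordinate `κ e` is almost `τ`. -/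
noncomputable def fill (P : List (Fin N)) (e : ℕ) : List (Fin N) :=
  P ++ (List.replicate (S.fillCount κ u τ P e) u).flatten

/-- The word with the first `e` zones; the `e`-th zone consists of `T e` copies of `i e`. -/
noncomputable def zoneWord : ℕ → List (Fin N)
  | 0 => []
  | e + 1 => S.fill κ u τ (zoneWord e) e ++ List.replicate (T e) (i e)

theorem zoneWord_prefix {e e' : ℕ} (h : e ≤ e') :
    S.zoneWord κ u i T τ e <+: S.zoneWord κ u i T τ e' := by
  induction e', h using Nat.le_induction with
  | base => exact List.prefix_rfl
  | succ n _ ih =>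
    refine ih.trans ?_
    rw [zoneWord, fill, List.append_assoc]
    exact List.prefix_append _ _

/-- Here `n` counts the copies of `u`. In all coordinates simultaneously the word looks like a power
of `u`, up to the letters of the zones, whose number does not depend on `τ`. -/
theorem exists_listLogSide_zoneWord {b : ℝ} (hb : ∀ i k, -Real.log (S.scale i k) ≤ b) (e : ℕ) :
    ∃ n : ℕ, ∀ k, n * S.listLogSide u k ≤ S.listLogSide (S.zoneWord κ u i T τ e) k ∧
      S.listLogSide (S.zoneWord κ u i T τ e) k ≤
        n * S.listLogSide u k + b * ∑ j ∈ Finset.range e, (T j : ℝ) := by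
  induction e with
  | zero => exact ⟨0, fun k => by simp [zoneWord]⟩
  | succ e ih =>
    obtain ⟨n, hn⟩ := ih
    refine ⟨n + S.fillCount κ u τ (S.zoneWord κ u i T τ e) e, fun k => ?_⟩
    obtain ⟨h1, h2⟩ := hn k
    rw [zoneWord, fill, listLogSide_append, listLogSide_append, listLogSide_flatten_replicate,
      listLogSide_replicate, Finset.sum_range_succ]
    push_cast
    have h3 : (T e : ℝ) * -Real.log (S.scale (i e) k) ≤ T e * b := by
      gcongr
      exact hb _ _
    have h4 : 0 ≤ (T e : ℝ) * -Real.log (S.scale (i e) k) :=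
      mul_nonneg (Nat.cast_nonneg _) (S.neg_log_scale_pos _ _).le
    constructor <;> linarith

theorem listLogSide_fill {P : List (Fin N)} {e : ℕ} (hu : u ≠ [])
    (hP : S.listLogSide P (κ e) ≤ τ) :
    S.listLogSide (S.fill κ u τ P e) (κ e) ≤ τ ∧
      τ ≤ S.listLogSide (S.fill κ u τ P e) (κ e) + S.listLogSide u (κ e) := by
  have hpos := S.listLogSide_pos hu (κ e)
  rw [fill, listLogSide_append, listLogSide_flatten_replicate]
  have h1 := Nat.floor_le (div_nonneg (sub_nonneg.mpr hP) hpos.le)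
  have h2 := Nat.lt_floor_add_one ((τ - S.listLogSide P (κ e)) / S.listLogSide u (κ e))
  rw [le_div_iff₀ hpos] at h1
  rw [div_lt_iff₀ hpos] at h2
  unfold fillCount
  constructor <;> linarith

/-- The next zone must not be missed. When the coordinate `κ e` is near `τ`, the copies of `u` have
brought `κ (e + 1)` only to at most `τ` times the ratio of their logarithmic sides; `hτ` says that
the remaining room exceeds what all zones so far can add. -/
theorem listLogSide_zoneWord_le (hu : u ≠ []) {D : ℕ} {b : ℝ} (hb : ∀ i k, -Real.log (S.scale i k) ≤ b) (hτ0 : 0 ≤ τ)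
    (hτ : ∀ e, e + 1 < D → (b * ∑ j ∈ Finset.range (e + 1), (T j : ℝ)) * S.listLogSide u (κ e) ≤
      τ * (S.listLogSide u (κ e) - S.listLogSide u (κ (e + 1)))) {e : ℕ} (he : e < D) :
    S.listLogSide (S.zoneWord κ u i T τ e) (κ e) ≤ τ := by
  induction e with
  | zero => simpa [zoneWord] using hτ0
  | succ e ih =>
    have ih := ih (by omega)
    obtain ⟨n, hn⟩ := S.exists_listLogSide_zoneWord κ u i T τ hb e
    have hfill := (S.listLogSide_fill κ u τ hu ih).1
    set m := S.fillCount κ u τ (S.zoneWord κ u i T τ e) e with hm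
    have hpos := S.listLogSide_pos hu (κ e)
    have hcyc : ((n : ℝ) + m) * S.listLogSide u (κ e) ≤ τ := by
      rw [fill, listLogSide_append, listLogSide_flatten_replicate] at hfill
      linarith [(hn (κ e)).1]
    have h1 : S.listLogSide (S.zoneWord κ u i T τ (e + 1)) (κ (e + 1)) ≤
        (n + m) * S.listLogSide u (κ (e + 1)) + b * ∑ j ∈ Finset.range (e + 1), (T j : ℝ) := by
      rw [zoneWord, fill, listLogSide_append, listLogSide_append, listLogSide_flatten_replicate,
        listLogSide_replicate, Finset.sum_range_succ]
      have h3 : (T e : ℝ) * -Real.log (S.scale (i e) (κ (e + 1))) ≤ T e * b := by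
        gcongr
        exact hb _ _
      linarith [(hn (κ (e + 1))).2]
    refine h1.trans ?_
    have h2 := hτ e he
    have h3 := mul_le_mul_of_nonneg_right hcyc (S.listLogSide_nonneg u (κ (e + 1)))
    rw [← mul_le_mul_iff_left₀ hpos]
    linarith

theorem exists_word_with_zones [NeZero N] (hu : u ≠ []) {D : ℕ}
    (hdec : ∀ e, e + 1 < D → S.listLogSide u (κ (e + 1)) < S.listLogSide u (κ e)) :
    ∀ᶠ τ : ℝ in Filter.atTop, ∃ (w : ℕ → Fin N) (start : ℕ → ℕ),
      (∀ e, start e + T e ≤ start (e + 1)) ∧ ∀ e < D,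
        (S.logSide w (start e) (κ e) ≤ τ ∧
          τ ≤ S.logSide w (start e) (κ e) + S.listLogSide u (κ e)) ∧
        ∀ l, start e ≤ l → l < start e + T e → w l = i e := by
  obtain ⟨a, b, -, -, hab⟩ := S.exists_bounds_log_scale
  have hev : ∀ᶠ τ : ℝ in Filter.atTop, ∀ e ∈ Finset.range (D - 1),
      (b * ∑ j ∈ Finset.range (e + 1), (T j : ℝ)) * S.listLogSide u (κ e) ≤
        τ * (S.listLogSide u (κ e) - S.listLogSide u (κ (e + 1))) := by
    refine (Filter.eventually_all_finset _).mpr fun e he => ?_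
    rw [Finset.mem_range] at he
    have := hdec e (by omega)
    exact (Filter.tendsto_id.atTop_mul_const (sub_pos.mpr this)).eventually_ge_atTop _
  filter_upwards [hev, Filter.eventually_ge_atTop 0] with τ hτ hτ0
  set P := S.zoneWord κ u i T τ with hPdef
  have hP : ∀ e < D, S.listLogSide (P e) (κ e) ≤ τ := fun e he =>
    S.listLogSide_zoneWord_le κ u i T τ hu (fun i k => (hab i k).2) hτ0
      (fun e he => hτ e (Finset.mem_range.mpr (by omega))) he
  have hPsucc : ∀ e, P (e + 1) = S.fill κ u τ (P e) e ++ List.replicate (T e) (i e) := fun e => rfl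
  -- A zone starts right after its filling; the letters `0` following the finite word play no role.
  refine ⟨fun l => (P D).getD l 0, fun e => (S.fill κ u τ (P e) e).length, fun e => ?_,
    fun e he => ?_⟩
  · have h1 : (S.fill κ u τ (P e) e).length + T e = (P (e + 1)).length := by
      rw [hPsucc, List.length_append, List.length_replicate]
    simp only [h1]
    rw [fill, List.length_append]
    exact Nat.le_add_right _ _
  · obtain ⟨v, hv⟩ := S.zoneWord_prefix κ u i T τ (show e + 1 ≤ D from he)
    rw [← hPdef, hPsucc] at hv
    constructor
    · have h1 := S.logSide_eq_listLogSide (S.fill κ u τ (P e) e)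
        (List.replicate (T e) (i e) ++ v) (κ e)
      rw [← List.append_assoc, hv] at h1
      rw [h1]
      exact S.listLogSide_fill κ u τ hu (hP e he)
    · intro l hl hl'
      dsimp only at hl hl' ⊢
      rw [← hv, List.append_assoc, List.getD_append_right _ _ _ _ hl,
        List.getD_append _ _ _ _ (by rw [List.length_replicate]; omega)]
      simp only [List.getD_eq_getElem?_getD, List.getElem?_replicate]
      rw [if_pos (by omega)]
      rfl

end Zones

/-- For an ordering in `𝓑` and any choice of letters there are words along which the energy grows
over a time interval of length `T` at the rate determined by the letters. -/
theorem exists_abs_energy_sub_le_of_mem_cylinderOrders [NeZero d] [NeZero N] {p : Fin N → ℝ}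
    (hp : ∀ i, 0 < p i) (hsum : ∑ i, p i = 1) {σ : Equiv.Perm (Fin d)} (hσ : σ ∈ S.cylinderOrders)
    (i : Fin d → Fin N) {x : Fin d → ℝ} (hx : ∀ n : Fin d,
      -Real.log (S.letterProb p σ n (i n)) = x n * -Real.log (S.scale (i n) (σ n))) :
    ∃ C : ℝ, ∀ T : ℝ, 0 < T → ∀ᶠ τ : ℝ in Filter.atTop, ∃ w : ℕ → Fin N,
      |S.energy p w (S.stoppingExp w (τ + T)) - S.energy p w (S.stoppingExp w τ) -
        (∑ n, x n) * T| ≤ C := by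
  obtain ⟨a, b, ha, hb, hab⟩ := S.exists_bounds_log_scale
  obtain ⟨C, hC, hstep⟩ := S.exists_abs_energy_sub_le hp hsum
  obtain ⟨u, hu, hmono⟩ := S.exists_list_of_mem_cylinderOrders hσ
  obtain ⟨c, hc⟩ : ∃ c, ∀ k, S.listLogSide u k ≤ c :=
    (Set.finite_range fun k => S.listLogSide u k).bddAbove.imp fun c hc k => hc ⟨k, rfl⟩
  have hc0 : 0 ≤ c := (S.listLogSide_nonneg u (σ 0)).trans (hc _)
  refine ⟨∑ n : Fin d, -Real.log (S.letterProb p σ n (i n)) + 2 * (C * (b + c)), fun T hT => ?_⟩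
  set β : Fin d → ℝ := fun n => -Real.log (S.scale (i n) (σ n)) with hβ
  have hβ0 : ∀ n, 0 < β n := fun n => S.neg_log_scale_pos _ _
  -- Just enough copies of `i n` to cover logarithmic length `T` in the coordinate `σ n`; the excess
  -- is at most one letter.
  set m : Fin d → ℕ := fun n => ⌈T / β n⌉₊ with hm
  have hm1 : ∀ n, T ≤ m n * β n := fun n => (div_le_iff₀ (hβ0 n)).mp (Nat.le_ceil _)
  have hm2 : ∀ n, m n * β n ≤ T + β n := fun n => by
    have := (Nat.ceil_lt_add_one (div_pos hT (hβ0 n)).le).le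
    rw [← mul_le_mul_iff_left₀ (hβ0 n), add_mul, div_mul_cancel₀ _ (hβ0 n).ne', one_mul] at this
    exact this
  -- Zones come in reverse order: the last coordinate of `σ` has the largest logarithmic side and
  -- reaches `τ` first.
  set ε : ℕ → Fin d := fun e => Fin.rev (Fin.ofNat d e) with hε
  have hεval : ∀ n : Fin d, ε (Fin.rev n) = n := fun n => by
    ext
    simp only [hε, Fin.val_rev, Fin.val_ofNat]
    rw [Nat.mod_eq_of_lt (by omega)]
    omega
  have hdec : ∀ e, e + 1 < d →
      S.listLogSide u (σ (ε (e + 1))) < S.listLogSide u (σ (ε e)) := by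
    intro e he
    refine hmono (Fin.lt_def.mpr ?_)
    simp only [hε, Fin.val_rev, Fin.val_ofNat, Nat.mod_eq_of_lt he,
      Nat.mod_eq_of_lt (show e < d by omega)]
    omega
  filter_upwards [S.exists_word_with_zones (fun e => σ (ε e)) u (fun e => i (ε e))
    (fun e => m (ε e)) hu hdec, Filter.eventually_gt_atTop 0] with τ ⟨w, start, hstart, hw⟩ hτ
  refine ⟨w, ?_⟩
  have hstart_mono : Monotone start :=
    monotone_nat_of_le_succ fun e => (Nat.le_add_right _ _).trans (hstart e)
  -- The exact beginnings and ends of the zones replace the stopping levels at `τ` and `τ + T`. Both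
  -- families are ordered by `σ` because the zones are disjoint, and each is within bounded
  -- logarithmic distance of the stopping levels.
  set L : Fin d → ℕ := fun k => start (Fin.rev (σ.symm k)) with hL
  set L' : Fin d → ℕ := fun k => start (Fin.rev (σ.symm k)) + m (σ.symm k) with hL'
  have hLσ : ∀ n, L (σ n) = start (Fin.rev n) := fun n => by simp [hL]
  have hLσ' : ∀ n, L' (σ n) = start (Fin.rev n) + m n := fun n => by simp [hL']
  have hanti : Antitone fun n => L (σ n) := by
    intro n n' h
    simp only [hLσ]
    exact hstart_mono (Fin.le_def.mp (Fin.rev_le_rev.mpr h))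
  have hanti' : Antitone fun n => L' (σ n) := by
    intro n n' h
    simp only [hLσ']
    rcases h.eq_or_lt with rfl | h
    · exact le_rfl
    · have h1 := hstart (Fin.rev n')
      simp only [hεval] at h1
      have h2 : start (Fin.rev n' + 1) ≤ start (Fin.rev n) :=
        hstart_mono (Fin.lt_def.mp (Fin.rev_lt_rev.mpr h))
      omega
  have hzone : ∀ n : Fin d, (S.logSide w (L (σ n)) (σ n) ≤ τ ∧
      τ ≤ S.logSide w (L (σ n)) (σ n) + S.listLogSide u (σ n)) ∧
      ∀ l, L (σ n) ≤ l → l < L' (σ n) → w l = i n := by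
    intro n
    have := hw (Fin.rev n) (Fin.rev n).2
    simpa only [hεval, hLσ, hLσ'] using this
  have hlog' : ∀ n, S.logSide w (L' (σ n)) (σ n) = S.logSide w (L (σ n)) (σ n) + m n * β n := by
    intro n
    have h1 := S.sum_Ico_neg_log_scale w (σ n) (show L (σ n) ≤ L' (σ n) by rw [hLσ, hLσ']; omega)
    rw [Finset.sum_congr rfl fun l hl => by
      rw [(hzone n).2 l (Finset.mem_Ico.mp hl).1 (Finset.mem_Ico.mp hl).2],
      Finset.sum_const, Nat.card_Ico, hLσ, hLσ', Nat.add_sub_cancel_left, nsmul_eq_mul] at h1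
    rw [hLσ, hLσ']
    linarith
  have hmain : S.energy p w L' - S.energy p w L =
      ∑ n : Fin d, m n * -Real.log (S.letterProb p σ n (i n)) := by
    rw [S.energy_sub_energy hp hsum w hanti hanti' fun k => Nat.le_add_right _ _]
    refine Finset.sum_congr rfl fun n _ => ?_
    rw [Finset.sum_congr rfl fun l hl => by
      rw [(hzone n).2 l (Finset.mem_Ico.mp hl).1 (Finset.mem_Ico.mp hl).2],
      Finset.sum_const, Nat.card_Ico, hLσ, hLσ', Nat.add_sub_cancel_left, nsmul_eq_mul]
  have hx0 : ∀ n, 0 ≤ x n := fun n => by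
    have h1 := S.neg_log_letterProb_nonneg hp σ n (i n)
    rw [hx] at h1
    exact nonneg_of_mul_nonneg_left h1 (hβ0 n)
  have hlow : (∑ n, x n) * T ≤ S.energy p w L' - S.energy p w L := by
    rw [hmain, Finset.sum_mul]
    refine Finset.sum_le_sum fun n _ => ?_
    rw [hx]
    have := mul_le_mul_of_nonneg_left (hm1 n) (hx0 n)
    simp only [hβ] at this
    linarith
  have hup : S.energy p w L' - S.energy p w L ≤
      (∑ n, x n) * T + ∑ n : Fin d, -Real.log (S.letterProb p σ n (i n)) := by
    rw [hmain, Finset.sum_mul, ← Finset.sum_add_distrib]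
    refine Finset.sum_le_sum fun n _ => ?_
    rw [hx]
    have := mul_le_mul_of_nonneg_left (hm2 n) (hx0 n)
    simp only [hβ] at this
    linarith
  have hnear : ∀ k, |S.logSide w (S.stoppingExp w τ k) k - S.logSide w (L k) k| ≤ b + c := by
    intro k
    obtain ⟨n, rfl⟩ := σ.surjective k
    obtain ⟨h1, h2⟩ := S.logSide_stoppingExp (fun i k => (hab i k).2) w hτ (σ n)
    obtain ⟨⟨h3, h4⟩, -⟩ := hzone n
    have h5 := hc (σ n)
    exact abs_le.mpr ⟨by linarith, by linarith⟩
  have hnear' : ∀ k, |S.logSide w (S.stoppingExp w (τ + T) k) k - S.logSide w (L' k) k| ≤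
      b + c := by
    intro k
    obtain ⟨n, rfl⟩ := σ.surjective k
    obtain ⟨h1, h2⟩ := S.logSide_stoppingExp (fun i k => (hab i k).2) w (add_pos hτ hT) (σ n)
    obtain ⟨⟨h3, h4⟩, -⟩ := hzone n
    have h5 := hc (σ n)
    have h6 := hm1 n
    have h7 := hm2 n
    have h8 : β n ≤ b := (hab _ _).2
    rw [hlog']
    exact abs_le.mpr ⟨by linarith, by linarith⟩
  have e1 := hstep w _ _ _ hnear
  have e2 := hstep w _ _ _ fun k => (abs_sub_comm _ _).trans_le (hnear k)
  have e3 := hstep w _ _ _ hnear'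
  have e4 := hstep w _ _ _ fun k => (abs_sub_comm _ _).trans_le (hnear' k)
  have e5 : 0 ≤ ∑ n : Fin d, -Real.log (S.letterProb p σ n (i n)) :=
    Finset.sum_nonneg fun n _ => S.neg_log_letterProb_nonneg hp σ n (i n)
  exact abs_le.mpr ⟨by linarith, by linarith⟩

end SpongeIFS

namespace SpongeIFS

variable {d N : ℕ} {S : SpongeIFS d N}

/-! ### Bounds coming from the orderings in `𝓑` -/

theorem upperTerm_of_subsingleton [NeZero N] [Subsingleton (Fin N)] {p : Fin N → ℝ}
    (hp : ∀ i, 0 < p i) (hsum : ∑ i, p i = 1) (σ : Equiv.Perm (Fin d)) (n : Fin d) :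
    S.upperTerm p σ n = 0 ∧ S.lowerTerm p σ n = 0 := by
  have hone : ∀ K i, S.agreeProb p K i = 1 := fun K i => by
    refine le_antisymm (S.agreeProb_le_one hp hsum K i) ?_
    rw [← hsum, Fintype.sum_subsingleton _ i]
    exact S.le_agreeProb hp K i
  have hlog : ∀ i, -Real.log (S.letterProb p σ n i) = 0 := fun i => by
    rw [S.letterProb_eq hp, hone, hone]
    simp
  obtain ⟨i, hi⟩ := S.exists_upperTerm p σ n
  obtain ⟨j, hj⟩ := S.exists_lowerTerm p σ n
  rw [hlog] at hi hj
  exact ⟨(mul_eq_zero.mp hi.symm).resolve_right (S.neg_log_scale_pos i (σ n)).ne',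
    (mul_eq_zero.mp hj.symm).resolve_right (S.neg_log_scale_pos j (σ n)).ne'⟩

theorem eq_of_overlap {σ : Equiv.Perm (Fin d)} {i j : Fin N} (h : S.Overlap σ d i j) : i = j := by
  by_contra hij
  obtain ⟨x, hx, hne⟩ := S.maps_ne i j hij
  refine hne ?_
  ext k
  have := congrArg (fun y : EuclideanSpace ℝ (Fin d) => y k) (h x hx)
  simpa [coordProj, map] using this

namespace IsSelfAffineMeasure

variable {p : Fin N → ℝ} {ν : Measure (EuclideanSpace ℝ (Fin d))}
  (hν : S.IsSelfAffineMeasure p ν) (hp : ∀ i, 0 < p i) (hsum : ∑ i, p i = 1)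
include hν hp hsum

/-- If the support is a point, all the maps fix it, so no two images of the cube are disjoint and
separation forces exact overlap. This settles the degenerate case, where all the sums vanish. -/
theorem subsingleton_of_diam_eq_zero [NeZero d] [NeZero N] (hS : S.VeryStrongSPPC)
    (hdiam : Metric.diam ν.support = 0) : Subsingleton (Fin N) := by
  refine ⟨fun i j => ?_⟩
  obtain ⟨σ, hσ, -⟩ := S.exists_cubeOrder (fun _ => 0) one_pos
  rcases hS σ hσ d (Nat.one_le_iff_ne_zero.mpr (NeZero.ne d)) le_rfl i j with h | h
  · exact eq_of_overlap h
  · exfalso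
    obtain ⟨x, hx, -⟩ := hν.exists_coded hp hsum fun _ => 0
    have hxc := hν.support_subset_unitCube hp hsum hx
    have h1 : S.map i x = S.map j x := by
      rw [← dist_le_zero, ← hdiam]
      exact Metric.dist_le_diam_of_mem (hν.isCompact_support hp hsum).isBounded
        (hν.map_mem_support hp i hx) (hν.map_mem_support hp j hx)
    exact Set.disjoint_left.mp h ⟨_, ⟨x, hxc, rfl⟩, rfl⟩ ⟨_, ⟨x, hxc, rfl⟩, by rw [h1]⟩

theorem le_assouadDim [NeZero d] [NeZero N] (hS : S.VeryStrongSPPC) {σ : Equiv.Perm (Fin d)}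
    (hσ : σ ∈ S.cylinderOrders) : (S.upperSum p σ : EReal) ≤ assouadDim ν := by
  refine le_sInf ?_
  rintro _ ⟨s, rfl, hs, K, hK, hbound⟩
  rw [EReal.coe_le_coe_iff]
  by_cases hdiam : Metric.diam ν.support = 0
  · have := hν.subsingleton_of_diam_eq_zero hp hsum hS hdiam
    refine (Finset.sum_eq_zero fun n _ => ?_).trans_le hs
    exact (upperTerm_of_subsingleton hp hsum σ n).1
  have hdiam' : 0 < Metric.diam ν.support := lt_of_le_of_ne Metric.diam_nonneg (Ne.symm hdiam)
  have hd : (1 : ℝ) ≤ d := by exact_mod_cast Nat.one_le_iff_ne_zero.mpr (NeZero.ne d)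
  obtain ⟨δ, hδ, hδ1, hball⟩ := hν.exists_real_closedBall_le hp hsum hS
  choose i hi using S.exists_upperTerm p σ
  obtain ⟨C, hC⟩ := S.exists_abs_energy_sub_le_of_mem_cylinderOrders hp hsum hσ i hi
  -- The radii compared are `d * exp (-τ)` and `δ / 2 * exp (-(τ + T))`, with quotient `2 * d / δ *
  -- exp T`. Large `τ` also keeps the larger radius below the diameter.
  refine le_of_forall_mul_le_mul_add (c := C + Real.log K + s * Real.log (2 * d / δ))
    (T₀ := 0) fun T hT => ?_
  have hlim : Filter.Tendsto (fun τ : ℝ => d * Real.exp (-τ)) Filter.atTop (nhds 0) := by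
    simpa using Real.tendsto_exp_neg_atTop_nhds_zero.const_mul (d : ℝ)
  obtain ⟨τ, ⟨w, hw⟩, hτdiam, hτ⟩ := ((hC T hT).and ((hlim.eventually_lt_const hdiam').and
    (Filter.eventually_gt_atTop 0))).exists
  obtain ⟨x, hx, hcode⟩ := hν.exists_coded hp hsum w
  have hR := hν.le_real_closedBall hp hsum hcode hτ le_rfl
  have hr := hball w x hcode (τ + T) (δ / 2 * Real.exp (-(τ + T))) (add_pos hτ hT)
    (by gcongr; linarith)
  have hr0 : 0 < δ / 2 * Real.exp (-(τ + T)) := by positivity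
  have hrR : δ / 2 * Real.exp (-(τ + T)) < d * Real.exp (-τ) := by
    have : Real.exp (-(τ + T)) < Real.exp (-τ) := Real.exp_lt_exp.mpr (by linarith)
    have h2 : δ / 2 * Real.exp (-(τ + T)) ≤ d * Real.exp (-(τ + T)) := by
      gcongr
      linarith
    have h3 : d * Real.exp (-(τ + T)) < d * Real.exp (-τ) := by gcongr
    linarith
  have hratio := hbound x hx _ _ hr0 hrR hτdiam
  have hrpos : 0 < ν.real (Metric.closedBall x (δ / 2 * Real.exp (-(τ + T)))) := by
    obtain ⟨t, ht0, ht⟩ : ∃ t : ℝ, 0 < t ∧ d * Real.exp (-t) ≤ δ / 2 * Real.exp (-(τ + T)) :=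
      ((Filter.eventually_gt_atTop 0).and
        ((hlim.eventually_lt_const hr0).mono fun _ h => h.le)).exists
    exact (Real.exp_pos _).trans_le (hν.le_real_closedBall hp hsum hcode ht0 ht)
  have hquot : Real.exp (S.energy p w (S.stoppingExp w (τ + T)) -
      S.energy p w (S.stoppingExp w τ)) ≤ K * (d * Real.exp (-τ) /
        (δ / 2 * Real.exp (-(τ + T)))) ^ s := by
    refine le_trans ?_ hratio
    rw [le_div_iff₀ hrpos]
    refine (mul_le_mul_of_nonneg_left hr (Real.exp_pos _).le).trans (le_trans ?_ hR)
    rw [← Real.exp_add, Real.exp_le_exp]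
    linarith
  have hval : d * Real.exp (-τ) / (δ / 2 * Real.exp (-(τ + T))) = 2 * d / δ * Real.exp T := by
    rw [show -τ = -(τ + T) + T by ring, Real.exp_add]
    have := (Real.exp_pos (-(τ + T))).ne'
    field_simp
  rw [hval, ← Real.le_log_iff_exp_le (by positivity), Real.log_mul hK.ne' (by positivity),
    Real.log_rpow (by positivity), Real.log_mul (by positivity) (by positivity), Real.log_exp,
    mul_add] at hquot
  have h1 := (abs_le.mp hw).1
  have h2 : S.upperSum p σ = ∑ n, S.upperTerm p σ n := rfl
  rw [h2]
  linarith

theorem lowerDim_le [NeZero d] [NeZero N] (hS : S.VeryStrongSPPC) {σ : Equiv.Perm (Fin d)}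
    (hσ : σ ∈ S.cylinderOrders) : lowerDim ν ≤ (S.lowerSum p σ : EReal) := by
  by_cases hdiam : Metric.diam ν.support = 0
  · rw [lowerDim, if_pos hdiam]
    exact_mod_cast S.lowerSum_nonneg hp σ
  rw [lowerDim, if_neg hdiam]
  refine sSup_le ?_
  rintro _ ⟨s, rfl, hs, K, hK, hbound⟩
  rw [EReal.coe_le_coe_iff]
  have hdiam' : 0 < Metric.diam ν.support := lt_of_le_of_ne Metric.diam_nonneg (Ne.symm hdiam)
  have hd : (1 : ℝ) ≤ d := by exact_mod_cast Nat.one_le_iff_ne_zero.mpr (NeZero.ne d)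
  obtain ⟨δ, hδ, hδ1, hball⟩ := hν.exists_real_closedBall_le hp hsum hS
  choose i hi using S.exists_lowerTerm p σ
  obtain ⟨C, hC⟩ := S.exists_abs_energy_sub_le_of_mem_cylinderOrders hp hsum hσ i hi
  -- The constants `d` and `δ / 2` now sit at the opposite radii, so `T > log (2 * d / δ)` is needed
  -- to keep `r < R`.
  refine le_of_forall_mul_le_mul_add (c := C - Real.log K - s * Real.log (δ / (2 * d)))
    (T₀ := max 0 (Real.log (2 * d / δ))) fun T hT => ?_
  obtain ⟨hT0, hT1⟩ := max_lt_iff.mp hT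
  have hlim : Filter.Tendsto (fun τ : ℝ => δ / 2 * Real.exp (-τ)) Filter.atTop (nhds 0) := by
    simpa using Real.tendsto_exp_neg_atTop_nhds_zero.const_mul (δ / 2)
  obtain ⟨τ, ⟨w, hw⟩, hτdiam, hτ⟩ := ((hC T hT0).and ((hlim.eventually_lt_const hdiam').and
    (Filter.eventually_gt_atTop 0))).exists
  obtain ⟨x, hx, hcode⟩ := hν.exists_coded hp hsum w
  have hr := hν.le_real_closedBall hp hsum hcode (add_pos hτ hT0) le_rfl
  have hR := hball w x hcode τ (δ / 2 * Real.exp (-τ)) hτ (by gcongr; linarith)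
  have hr0 : 0 < d * Real.exp (-(τ + T)) := by positivity
  have hrR : d * Real.exp (-(τ + T)) < δ / 2 * Real.exp (-τ) := by
    rw [Real.log_lt_iff_lt_exp (by positivity), div_lt_iff₀ hδ] at hT1
    rw [show -τ = -(τ + T) + T by ring, Real.exp_add]
    have := mul_lt_mul_of_pos_right hT1 (Real.exp_pos (-(τ + T)))
    linarith
  have hratio := hbound x hx _ _ hr0 hrR hτdiam
  have hquot : K * (δ / 2 * Real.exp (-τ) / (d * Real.exp (-(τ + T)))) ^ s ≤
      Real.exp (S.energy p w (S.stoppingExp w (τ + T)) - S.energy p w (S.stoppingExp w τ)) := by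
    refine hratio.trans ?_
    rw [div_le_iff₀ ((Real.exp_pos _).trans_le hr)]
    refine hR.trans (le_trans ?_ (mul_le_mul_of_nonneg_left hr (Real.exp_pos _).le))
    rw [← Real.exp_add, Real.exp_le_exp]
    linarith
  have hval : δ / 2 * Real.exp (-τ) / (d * Real.exp (-(τ + T))) = δ / (2 * d) * Real.exp T := by
    rw [show -τ = -(τ + T) + T by ring, Real.exp_add]
    have := (Real.exp_pos (-(τ + T))).ne'
    field_simp
  rw [hval, ← Real.log_le_iff_le_exp (by positivity), Real.log_mul hK.ne' (by positivity),
    Real.log_rpow (by positivity), Real.log_mul (by positivity) (by positivity), Real.log_exp,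
    mul_add] at hquot
  have h1 := (abs_le.mp hw).2
  have h2 : S.lowerSum p σ = ∑ n, S.lowerTerm p σ n := rfl
  rw [h2]
  linarith

end IsSelfAffineMeasure

/-! ### Existence of strictly ordered cylinders -/

variable (S)

/-- For each pair of coordinates the sum is a polynomial in `M`, nonzero because the coordinates are
distinguishable. The product over all pairs has finitely many roots. -/
theorem exists_nat_sum_pow_mul_ne_zero :
    ∃ M : ℕ, ∀ k m : Fin d, k ≠ m →
      ∑ i : Fin N, (M : ℝ) ^ (i : ℕ) * (Real.log (S.scale i k) - Real.log (S.scale i m)) ≠ 0 := by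
  classical
  set Q : Fin d × Fin d → Polynomial ℝ := fun x => ∑ i : Fin N,
    Polynomial.C (Real.log (S.scale i x.1) - Real.log (S.scale i x.2)) * Polynomial.X ^ (i : ℕ)
  have hQ : ∀ x : Fin d × Fin d, x.1 ≠ x.2 → Q x ≠ 0 := by
    rintro ⟨k, m⟩ hkm h0
    obtain ⟨i, hi⟩ := S.distinguishable k m hkm
    have h1 := congrArg (fun q => Polynomial.coeff q (i : ℕ)) h0
    simp only [Q, Polynomial.finsetSum_coeff, Polynomial.coeff_C_mul_X_pow, Fin.val_inj,
      Polynomial.coeff_zero, Finset.sum_ite_eq, Finset.mem_univ, if_true] at h1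
    exact hi (Real.log_injOn_pos (S.scale_pos i k) (S.scale_pos i m) (sub_eq_zero.mp h1))
  set P : Polynomial ℝ := ∏ x ∈ Finset.univ.filter fun x : Fin d × Fin d => x.1 ≠ x.2, Q x
  have hP : P ≠ 0 := Finset.prod_ne_zero_iff.mpr fun x hx => hQ x (Finset.mem_filter.mp hx).2
  obtain ⟨M, hM⟩ : ∃ M : ℕ, ¬ P.IsRoot (M : ℝ) := by
    by_contra! h
    refine hP (Polynomial.eq_zero_of_infinite_isRoot P ?_)
    exact (Set.infinite_range_of_injective (f := fun n : ℕ => (n : ℝ)) Nat.cast_injective).mono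
      (by rintro _ ⟨n, rfl⟩; exact h n)
  refine ⟨M, fun k m hkm h0 => hM ?_⟩
  rw [Polynomial.IsRoot, Polynomial.eval_prod]
  refine Finset.prod_eq_zero (Finset.mem_filter.mpr ⟨Finset.mem_univ (k, m), hkm⟩) ?_
  rw [← h0, Polynomial.eval_finsetSum]
  refine Finset.sum_congr rfl fun i _ => ?_
  simp [mul_comm]

theorem exists_list_injective [NeZero N] :
    ∃ u : List (Fin N), u ≠ [] ∧ Function.Injective fun k => S.listLogSide u k := by
  obtain ⟨M, hM⟩ := S.exists_nat_sum_pow_mul_ne_zero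
  have hval : ∀ k, S.listLogSide
      ((List.finRange N).flatMap fun i : Fin N => List.replicate (M ^ (i : ℕ)) i) k =
      ∑ i : Fin N, (M : ℝ) ^ (i : ℕ) * -Real.log (S.scale i k) := by
    intro k
    have haux : ∀ l : List (Fin N), S.listLogSide
        (l.flatMap fun i : Fin N => List.replicate (M ^ (i : ℕ)) i) k =
        (l.map fun i : Fin N => (M : ℝ) ^ (i : ℕ) * -Real.log (S.scale i k)).sum := by
      intro l
      induction l with
      | nil => rfl
      | cons i l ih =>
        rw [List.flatMap_cons, listLogSide_append, ih, listLogSide_replicate, List.map_cons,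
          List.sum_cons]
        push_cast
        rfl
    rw [haux, ← Fin.sum_univ_def]
  refine ⟨(List.finRange N).flatMap fun i : Fin N => List.replicate (M ^ (i : ℕ)) i, ?_, ?_⟩
  -- The letter `0` occurs `M ^ 0 = 1` times, even if `M = 0`.
  · refine List.ne_nil_of_mem (a := 0) (List.mem_flatMap.mpr ⟨0, List.mem_finRange 0, ?_⟩)
    simp
  · intro k m hkm
    by_contra hne
    refine hM k m hne ?_
    simp only [hval] at hkm
    rw [← sub_eq_zero, ← Finset.sum_sub_distrib] at hkm
    rw [← neg_eq_zero, ← Finset.sum_neg_distrib, ← hkm]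
    exact Finset.sum_congr rfl fun i _ => by ring

theorem cylinderOrders_nonempty [NeZero d] [NeZero N] : S.cylinderOrders.Nonempty := by
  obtain ⟨u, hu, hinj⟩ := S.exists_list_injective
  set σ := Tuple.sort fun k => S.listLogSide u k
  have hmono : StrictMono fun n => S.listLogSide u (σ n) :=
    (Tuple.monotone_sort fun k => S.listLogSide u k).strictMono_of_injective
      (hinj.comp σ.injective)
  set w : ℕ → Fin N := fun l => (u ++ []).getD l 0
  have hw : ∀ k, S.logSide w u.length k = S.listLogSide u k := fun k =>
    S.logSide_eq_listLogSide u [] k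
  obtain ⟨a, b, ha, -, hab⟩ := S.exists_bounds_log_scale
  set k₀ := σ ⟨d - 1, Nat.sub_one_lt (NeZero.ne d)⟩ with hk₀
  have h0 : 0 < S.side w u.length k₀ := S.side_pos _ _ _
  have h1 : S.side w u.length k₀ < 1 := by
    rw [side_eq_exp, Real.exp_lt_one_iff, neg_lt_zero, hw]
    exact S.listLogSide_pos hu _
  -- Sides decrease strictly with the level, so stopping at the scale equal to the side of `u`
  -- itself happens exactly at its end.
  have hlevel : S.stopping w (S.side w u.length k₀) k₀ = u.length := by
    obtain ⟨-, h2, h3⟩ := S.stopping_spec w h0 h1 k₀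
    set L := S.stopping w (S.side w u.length k₀) k₀
    rw [side_eq_exp, side_eq_exp, Real.exp_le_exp] at h2
    have h4 : L - 1 < u.length := by
      by_contra! h
      exact absurd (S.side_anti w k₀ h) (not_le.mpr h3)
    by_contra hne
    have hlt : L < u.length := by omega
    have h5 := S.mul_le_logSide_sub (fun i k => (hab i k).1) w k₀ hlt.le
    have h6 : (L : ℝ) < u.length := by exact_mod_cast hlt
    have h7 : 0 < a * ((u.length : ℝ) - L) := mul_pos ha (by linarith)
    linarith
  refine ⟨σ, w, S.side w u.length k₀, h0, h1, fun m n hmn => ?_⟩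
  simp only [← hk₀, hlevel]
  simp only [side_eq_exp, Real.exp_lt_exp, neg_lt_neg_iff, hw]
  exact hmono hmn

/-! ### Coordinate-wise natural measures -/

theorem fibreDim_spec (σ : Equiv.Perm (Fin d)) (n : Fin d) {i : Fin N} (hi : i ∈ S.index σ n) :
    ∑ j ∈ S.fibre σ n i, S.scale j (σ n) ^ S.fibreDim σ n i = 1 := by
  rw [fibreDim, dif_pos hi]
  exact (S.existsUnique_fibreDim σ n hi).choose_spec.1

theorem naturalProb_pos (σ : Equiv.Perm (Fin d)) (i : Fin N) : 0 < S.naturalProb σ i :=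
  Finset.prod_pos fun _ _ => Real.rpow_pos_of_pos (S.scale_pos _ _) _

/-- The product of the first `n` factors of `naturalProb`. -/
noncomputable def naturalPart (σ : Equiv.Perm (Fin d)) (n : ℕ) (i : Fin N) : ℝ :=
  ∏ m ∈ Finset.univ.filter (fun m : Fin d => (m : ℕ) < n),
    S.scale (S.proj σ (m + 1) i) (σ m) ^ S.fibreDim σ m (S.proj σ m i)

theorem naturalPart_pos (σ : Equiv.Perm (Fin d)) (n : ℕ) (i : Fin N) : 0 < S.naturalPart σ n i :=
  Finset.prod_pos fun _ _ => Real.rpow_pos_of_pos (S.scale_pos _ _) _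

theorem naturalPart_succ (σ : Equiv.Perm (Fin d)) (n : Fin d) {i : Fin N}
    (hi : i ∈ S.index σ (n + 1)) :
    S.naturalPart σ (n + 1) i =
      S.scale i (σ n) ^ S.fibreDim σ n (S.proj σ n i) * S.naturalPart σ n (S.proj σ n i) := by
  have hset : (Finset.univ.filter fun m : Fin d => (m : ℕ) < n + 1) =
      insert n (Finset.univ.filter fun m : Fin d => (m : ℕ) < n) := by
    ext m
    simp only [Finset.mem_filter, Finset.mem_univ, true_and, Finset.mem_insert, Fin.ext_iff]
    omega
  rw [naturalPart, hset, Finset.prod_insert (by simp), S.proj_eq_self hi]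
  congr 1
  refine Finset.prod_congr rfl fun m hm => ?_
  have hm : (m : ℕ) < n := (Finset.mem_filter.mp hm).2
  rw [S.proj_proj_of_le σ hm i, S.proj_proj_of_le σ hm.le i]

/-- Downward induction from `n = d`, where projections are trivial: summing over the fibre above `i`
removes the last factor, by the defining equation of `fibreDim`. -/
theorem projProb_naturalProb (σ : Equiv.Perm (Fin d)) {n : ℕ} (hn : n ≤ d) {i : Fin N}
    (hi : i ∈ S.index σ n) : S.projProb (S.naturalProb σ) σ n i = S.naturalPart σ n i := by
  induction hn using Nat.decreasingInduction generalizing i with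
  | self =>
    have hfilter : (Finset.univ.filter fun j => S.proj σ d j = i) = {i} := by
      ext j
      simp only [Finset.mem_filter, Finset.mem_univ, true_and, Finset.mem_singleton]
      constructor
      · rintro rfl
        exact (eq_of_overlap (S.overlap_proj σ d j)).symm
      · rintro rfl
        exact S.proj_eq_self hi
    rw [projProb, hfilter, Finset.sum_singleton, naturalProb, naturalPart,
      Finset.filter_true_of_mem fun m _ => m.2]
  | of_succ n hn ih =>
    have hmaps : ∀ j ∈ Finset.univ.filter (fun j => S.proj σ n j = i),
        S.proj σ (n + 1) j ∈ S.fibre σ n i := by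
      intro j hj
      refine Finset.mem_filter.mpr ⟨S.proj_mem_index σ _ j, ?_⟩
      rw [S.proj_proj_of_le σ (Nat.le_succ n)]
      exact (Finset.mem_filter.mp hj).2
    rw [projProb, ← Finset.sum_fiberwise_of_maps_to hmaps]
    have hinner : ∀ j ∈ S.fibre σ n i,
        ∑ j' ∈ Finset.univ.filter (fun j => S.proj σ n j = i) with S.proj σ (n + 1) j' = j,
          S.naturalProb σ j' =
        S.scale j (σ ⟨n, hn⟩) ^ S.fibreDim σ ⟨n, hn⟩ i * S.naturalPart σ n i := by
      intro j hj
      obtain ⟨hj1, hj2⟩ := Finset.mem_filter.mp hj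
      have h1 := S.naturalPart_succ σ ⟨n, hn⟩ hj1
      simp only [hj2] at h1
      rw [← h1, ← ih hj1, projProb, Finset.filter_filter]
      congr 1
      ext j'
      simp only [Finset.mem_filter, Finset.mem_univ, true_and, and_iff_right_iff_imp]
      rintro rfl
      rw [← hj2, S.proj_proj_of_le σ (Nat.le_succ n)]
    rw [Finset.sum_congr rfl hinner, ← Finset.sum_mul]
    have := S.fibreDim_spec σ ⟨n, hn⟩ hi
    simp only at this
    rw [this, one_mul]

theorem sum_naturalProb [NeZero N] (σ : Equiv.Perm (Fin d)) : ∑ i, S.naturalProb σ i = 1 := by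
  have h0 : (0 : Fin N) ∈ S.index σ 0 := by simp [S.index_zero σ]
  have h := S.projProb_naturalProb σ (Nat.zero_le d) h0
  have hall : ∀ j, S.proj σ 0 j = 0 := fun j => by
    have := S.proj_mem_index σ 0 j
    rwa [S.index_zero σ, Finset.mem_singleton] at this
  rw [projProb, Finset.filter_true_of_mem fun j _ => hall j] at h
  rw [h]
  simp [naturalPart]

theorem log_condProb_naturalProb (σ : Equiv.Perm (Fin d)) (n : Fin d) {i : Fin N}
    (hi : i ∈ S.index σ (n + 1)) :
    Real.log (S.condProb (S.naturalProb σ) σ n i) / Real.log (S.scale i (σ n)) =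
      S.fibreDim σ n (S.proj σ n i) := by
  rw [condProb, S.projProb_naturalProb σ n.2 hi,
    S.projProb_naturalProb σ n.2.le (S.proj_mem_index σ n i), S.naturalPart_succ σ n hi,
    mul_div_cancel_right₀ _ (S.naturalPart_pos σ n _).ne', Real.log_rpow (S.scale_pos _ _),
    mul_div_cancel_right₀ _ (Real.log_neg (S.scale_pos _ _) (S.scale_lt_one _ _)).ne]

/-- The ratio at `i` depends only on the projection of `i` to level `n`, and that projection maps
onto the index set of level `n`. -/
theorem upperTerm_naturalProb [NeZero N] (σ : Equiv.Perm (Fin d)) (n : Fin d) :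
    S.upperTerm (S.naturalProb σ) σ n =
      (S.index σ n).sup' (S.index_nonempty σ n) fun i => S.fibreDim σ n i := by
  refine le_antisymm (Finset.sup'_le _ _ fun i hi => ?_) (Finset.sup'_le _ _ fun i hi => ?_)
  · rw [S.log_condProb_naturalProb σ n hi]
    exact Finset.le_sup' (fun i => S.fibreDim σ n i) (S.proj_mem_index σ n i)
  · have h := S.log_condProb_naturalProb σ n (S.proj_mem_index σ (n + 1) i)
    rw [S.proj_proj_of_le σ (Nat.le_succ n), S.proj_eq_self hi] at h
    rw [← h]
    exact Finset.le_sup' (fun i => Real.log (S.condProb (S.naturalProb σ) σ n i) /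
      Real.log (S.scale i (σ n))) (S.proj_mem_index σ (n + 1) i)

theorem lowerTerm_naturalProb [NeZero N] (σ : Equiv.Perm (Fin d)) (n : Fin d) :
    S.lowerTerm (S.naturalProb σ) σ n =
      (S.index σ n).inf' (S.index_nonempty σ n) fun i => S.fibreDim σ n i := by
  refine le_antisymm (Finset.le_inf' _ _ fun i hi => ?_) (Finset.le_inf' _ _ fun i hi => ?_)
  · have h := S.log_condProb_naturalProb σ n (S.proj_mem_index σ (n + 1) i)
    rw [S.proj_proj_of_le σ (Nat.le_succ n), S.proj_eq_self hi] at h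
    rw [← h]
    exact Finset.inf'_le (fun i => Real.log (S.condProb (S.naturalProb σ) σ n i) /
      Real.log (S.scale i (σ n))) (S.proj_mem_index σ (n + 1) i)
  · rw [S.log_condProb_naturalProb σ n hi]
    exact Finset.inf'_le (fun i => S.fibreDim σ n i) (S.proj_mem_index σ n i)

theorem upperSum_naturalProb [NeZero d] [NeZero N] (σ : Equiv.Perm (Fin d)) :
    S.upperSum (S.naturalProb σ) σ = S.fibreDim σ 0 0 +
      ∑ n ∈ (Finset.univ : Finset (Fin d)).erase 0,
        (S.index σ n).sup' (S.index_nonempty σ n) (fun i => S.fibreDim σ n i) := by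
  have h : S.upperSum (S.naturalProb σ) σ = ∑ n : Fin d,
      (S.index σ n).sup' (S.index_nonempty σ n) (fun i => S.fibreDim σ n i) :=
    Finset.sum_congr rfl fun n _ => S.upperTerm_naturalProb σ n
  rw [h, ← Finset.add_sum_erase _ _ (Finset.mem_univ (0 : Fin d))]
  congr 1
  simp [S.index_zero σ]

theorem lowerSum_naturalProb [NeZero d] [NeZero N] (σ : Equiv.Perm (Fin d)) :
    S.lowerSum (S.naturalProb σ) σ = S.fibreDim σ 0 0 +
      ∑ n ∈ (Finset.univ : Finset (Fin d)).erase 0,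
        (S.index σ n).inf' (S.index_nonempty σ n) (fun i => S.fibreDim σ n i) := by
  have h : S.lowerSum (S.naturalProb σ) σ = ∑ n : Fin d,
      (S.index σ n).inf' (S.index_nonempty σ n) (fun i => S.fibreDim σ n i) :=
    Finset.sum_congr rfl fun n _ => S.lowerTerm_naturalProb σ n
  rw [h, ← Finset.add_sum_erase _ _ (Finset.mem_univ (0 : Fin d))]
  congr 1
  simp [S.index_zero σ]

theorem cubeOrders_nonempty [NeZero N] : S.cubeOrders.Nonempty := by
  obtain ⟨σ, hσ, -⟩ := S.exists_cubeOrder (fun _ => 0) one_pos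
  exact ⟨σ, hσ⟩

end SpongeIFS

/-! ### The main theorem -/

theorem theorem2p5 {d N : ℕ} [NeZero d] [NeZero N] (S : SpongeIFS d N) (hS : S.VeryStrongSPPC) :
    S.cylinderOrders.Nonempty ∧ S.cubeOrders.Nonempty ∧
    (∀ p : Fin N → ℝ, (∀ i, 0 < p i) → ∑ i, p i = 1 →
      ∀ ν : MeasureTheory.Measure (EuclideanSpace ℝ (Fin d)), S.IsSelfAffineMeasure p ν →
        ((⨆ σ ∈ S.cylinderOrders, (S.upperSum p σ : EReal)) ≤ assouadDim ν ∧
          assouadDim ν ≤ ⨆ σ ∈ S.cubeOrders, (S.upperSum p σ : EReal)) ∧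
        ((⨅ σ ∈ S.cubeOrders, (S.lowerSum p σ : EReal)) ≤ lowerDim ν ∧
          lowerDim ν ≤ ⨅ σ ∈ S.cylinderOrders, (S.lowerSum p σ : EReal))) ∧
    ∀ σ ∈ S.cubeOrders,
      (∀ i, 0 < S.naturalProb σ i) ∧ ∑ i, S.naturalProb σ i = 1 ∧
      S.upperSum (S.naturalProb σ) σ = S.fibreDim σ 0 0 +
        ∑ n ∈ (Finset.univ : Finset (Fin d)).erase 0,
          (S.index σ n).sup' (S.index_nonempty σ n) (fun i => S.fibreDim σ n i) ∧
      S.lowerSum (S.naturalProb σ) σ = S.fibreDim σ 0 0 +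
        ∑ n ∈ (Finset.univ : Finset (Fin d)).erase 0,
          (S.index σ n).inf' (S.index_nonempty σ n) (fun i => S.fibreDim σ n i) := by
  refine ⟨S.cylinderOrders_nonempty, S.cubeOrders_nonempty, fun p hp hsum ν hν =>
    ⟨⟨iSup₂_le fun σ hσ => hν.le_assouadDim hp hsum hS hσ, ?_⟩, ?_,
      le_iInf₂ fun σ hσ => hν.lowerDim_le hp hsum hS hσ⟩,
    fun σ _ => ⟨S.naturalProb_pos σ, S.sum_naturalProb σ, S.upperSum_naturalProb σ,
      S.lowerSum_naturalProb σ⟩⟩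
  -- Finiteness of `𝓐` makes the extended-real supremum a maximum, which supplies the real rate `h`.
  · obtain ⟨σ, hσ, hmax⟩ := Set.exists_max_image S.cubeOrders (S.upperSum p) (Set.toFinite _)
      S.cubeOrders_nonempty
    exact (hν.assouadDim_le hp hsum hS hmax).trans
      (le_iSup₂ (f := fun σ (_ : σ ∈ S.cubeOrders) => (S.upperSum p σ : EReal)) σ hσ)
  · obtain ⟨σ, hσ, hmin⟩ := Set.exists_min_image S.cubeOrders (S.lowerSum p) (Set.toFinite _)
      S.cubeOrders_nonempty
    refine (iInf₂_le (f := fun σ (_ : σ ∈ S.cubeOrders) => (S.lowerSum p σ : EReal)) σ hσ).trans ?_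
    by_cases hdiam : Metric.diam ν.support = 0
    · have := hν.subsingleton_of_diam_eq_zero hp hsum hS hdiam
      have h0 : S.lowerSum p σ = 0 :=
        Finset.sum_eq_zero fun n _ => (SpongeIFS.upperTerm_of_subsingleton hp hsum σ n).2
      rw [lowerDim, if_pos hdiam, h0, EReal.coe_zero]
    · exact hν.le_lowerDim hp hsum hS hdiam hmin (S.lowerSum_nonneg hp σ)
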